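/- Let $M$ be a smooth $d$-dimensional manifold, and let $\tilde g=\tilde g_{\mu\nu}(x,\rho)\,dx^\mu dx^\nu$ be a family of (pseudo-Riemannian) metrics on $M$ of arbitrary signature, defined and smooth in $(x,\rho)$ on an open subset $\Omega\subseteq M\times\mathbb R$. Consider on the set of all $(t,x,\rho)$ with $t>0$ and $(x,\rho)\in\Omega$ the ambient metric $$\mathbf g=2\rho\,dt^2+2t\,dt\,d\rho+t^2\,\tilde g_{\mu\nu}(x,\rho)\,dx^\mu dx^\nu ,$$ and let $\mathbf S_{IJ}$, $I,J\in\{0,\mu,\infty\}$, be the components of its Ricci tensor in the coordinates $(t,x^\mu,\rho)$, where $x^\mu$ are the coordinates of any smooth chart of $M$, the index $0$ belongs to $t$ and the index $\infty$ to $\rho$. Then $\mathbf S_{0I}=\mathbf S_{I0}=0$ for all $I$, and $\mathbf S_{IJ}$ does not depend on $t$, so that $$\tilde S_{\mu\nu}:=\mathbf S_{\mu\nu},\qquad \tilde S_{\mu\infty}:=\mathbf S_{\mu\infty},\qquad \tilde S_{\infty\infty}:=\mathbf S_{\infty\infty}$$ are functions of $(x,\rho)$. Moreover, at every point of $\Omega$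 the following two identities hold, the first one for every index $\nu$: $$\tilde\nabla^{\mu}\Big(\tilde S_{\mu\nu}-\tfrac12\tilde g_{\mu\nu}\tilde S\Big)+\rho\,\partial_\nu\tilde S_{\infty\infty}+(d-2-2\rho\,\partial_\infty)\tilde S_{\nu\infty}-\rho\,\tilde g^{\xi\chi}\tilde g'_{\xi\chi}\,\tilde S_{\nu\infty}=0,$$ $$\tilde\nabla^{\mu}\tilde S_{\mu\infty}+(d-2-\rho\,\partial_\infty)\tilde S_{\infty\infty}-\rho\,\tilde g^{\mu\nu}\tilde g'_{\mu\nu}\,\tilde S_{\infty\infty}-\tfrac12\,\tilde g'_{\mu\nu}\tilde S^{\mu\nu}-\tfrac12\,\partial_\infty\tilde S=0 .$$ Here $\tilde S=\tilde g^{\mu\nu}\tilde S_{\mu\nu}$, indices are raised with $\tilde g$, $\tilde\nabla$ is the Levi-Civita connection of $\tilde g(\cdot,\rho)$ on $M$ for fixed $\rho$, and $\partial_\infty$ and the prime both denote the derivative with respect to $\rho$. -/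

import Mathlib

open scoped Manifold ContDiff

noncomputable section

namespace AmbientBianchi

section Coordinates

/-! Coordinate expressions on the space `ι → ℝ`, for a finite set `ι` of coordinate indices. -/

variable {ι : Type*} [Fintype ι] [DecidableEq ι]

/-- The partial derivative `∂_i f` at `x`. -/
def pd (i : ι) (f : (ι → ℝ) → ℝ) (x : ι → ℝ) : ℝ :=
  fderiv ℝ f x (Pi.single i 1)

/-- The Christoffel symbol `Γ^k_{ij} = ½ g^{kl} (∂_i g_{lj} + ∂_j g_{li} - ∂_l g_{ij})`
of the Levi-Civita connection of `g`. -/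
def christoffel (g : (ι → ℝ) → Matrix ι ι ℝ) (k i j : ι) (x : ι → ℝ) : ℝ :=
  (1 / 2 : ℝ) * ∑ l, (g x)⁻¹ k l *
    (pd i (fun y => g y l j) x + pd j (fun y => g y l i) x - pd l (fun y => g y i j) x)

/-- The Ricci tensor `R_{ij} = ∂_k Γ^k_{ij} - ∂_j Γ^k_{ik} + Γ^k_{kl} Γ^l_{ij} - Γ^k_{jl} Γ^l_{ik}`
of `g`. -/
def ricci (g : (ι → ℝ) → Matrix ι ι ℝ) (i j : ι) (x : ι → ℝ) : ℝ :=
  (∑ k, pd k (christoffel g k i j) x) - (∑ k, pd j (christoffel g k i k) x)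
    + (∑ k, ∑ l, christoffel g k k l x * christoffel g l i j x)
    - ∑ k, ∑ l, christoffel g k j l x * christoffel g l i k x

/-- The covariant derivative `∇_k θ_i` of a one-form. -/
def covDeriv₁ (g : (ι → ℝ) → Matrix ι ι ℝ) (θ : (ι → ℝ) → ι → ℝ)
    (k i : ι) (x : ι → ℝ) : ℝ :=
  pd k (fun y => θ y i) x - ∑ l, christoffel g l k i x * θ x l

/-- The covariant derivative `∇_k T_{ij}` of a covariant two-tensor. -/
def covDeriv₂ (g : (ι → ℝ) → Matrix ι ι ℝ) (T : (ι → ℝ) → Matrix ι ι ℝ)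
    (k i j : ι) (x : ι → ℝ) : ℝ :=
  pd k (fun y => T y i j) x - (∑ l, christoffel g l k i x * T x l j)
    - ∑ l, christoffel g l k j x * T x i l

/-- The divergence `∇^i θ_i = g^{ik} ∇_k θ_i`. -/
def div₁ (g : (ι → ℝ) → Matrix ι ι ℝ) (θ : (ι → ℝ) → ι → ℝ) (x : ι → ℝ) : ℝ :=
  ∑ i, ∑ k, (g x)⁻¹ i k * covDeriv₁ g θ k i x

/-- The divergence `∇^i T_{ij} = g^{ik} ∇_k T_{ij}`. -/
def div₂ (g : (ι → ℝ) → Matrix ι ι ℝ) (T : (ι → ℝ) → Matrix ι ι ℝ) (j : ι) (x : ι → ℝ) : ℝ :=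
  ∑ i, ∑ k, (g x)⁻¹ i k * covDeriv₂ g T k i j x

end Coordinates

section Ambient

variable {d : ℕ}

/-- The ambient coordinate indices: `0` (for `t`), `μ ∈ Fin d` (for `x^μ`) and `∞` (for `ρ`). -/
abbrev AmbientIndex (d : ℕ) : Type := Unit ⊕ (Fin d ⊕ Unit)

/-- The index `0`. -/
abbrev zeroIdx : AmbientIndex d := Sum.inl ()

/-- The index `μ`. -/
abbrev spaceIdx (μ : Fin d) : AmbientIndex d := Sum.inr (Sum.inl μ)

/-- The index `∞`. -/
abbrev inftyIdx : AmbientIndex d := Sum.inr (Sum.inr ())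

/-- The point of the ambient space with coordinates `(t, x, ρ)`. -/
def ambientPoint (t : ℝ) (x : Fin d → ℝ) (ρ : ℝ) : AmbientIndex d → ℝ
  | Sum.inl _ => t
  | Sum.inr (Sum.inl μ) => x μ
  | Sum.inr (Sum.inr _) => ρ

/-- The components of `2 ρ dt² + 2 t dt dρ + t² g_{μν}(x, ρ) dx^μ dx^ν` at `X = (t, x, ρ)`. -/
def ambientMetric (g : (Fin d → ℝ) → ℝ → Matrix (Fin d) (Fin d) ℝ) (X : AmbientIndex d → ℝ) :
    Matrix (AmbientIndex d) (AmbientIndex d) ℝ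
  | Sum.inl _, Sum.inl _ => 2 * X inftyIdx
  | Sum.inl _, Sum.inr (Sum.inr _) => X zeroIdx
  | Sum.inr (Sum.inr _), Sum.inl _ => X zeroIdx
  | Sum.inr (Sum.inl μ), Sum.inr (Sum.inl ν) =>
      X zeroIdx ^ 2 * g (fun i => X (spaceIdx i)) (X inftyIdx) μ ν
  | _, _ => 0

/-- The component `S_{IJ}` at `(t, x, ρ)` of the Ricci tensor of the ambient metric. -/
def ambientRicci (g : (Fin d → ℝ) → ℝ → Matrix (Fin d) (Fin d) ℝ) (I J : AmbientIndex d)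
    (t : ℝ) (x : Fin d → ℝ) (ρ : ℝ) : ℝ :=
  ricci (ambientMetric g) I J (ambientPoint t x ρ)

/-- The component `S_{IJ}` of the ambient Ricci tensor as a function of `(x, ρ)`, read off on the
slice `t = 1`. -/
def slicedRicci (g : (Fin d → ℝ) → ℝ → Matrix (Fin d) (Fin d) ℝ) (I J : AmbientIndex d)
    (x : Fin d → ℝ) (ρ : ℝ) : ℝ :=
  ambientRicci g I J 1 x ρ

/-- `S_{μν}` on `(x, ρ)`-space. -/
def S (g : (Fin d → ℝ) → ℝ → Matrix (Fin d) (Fin d) ℝ) (x : Fin d → ℝ) (ρ : ℝ) :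
    Matrix (Fin d) (Fin d) ℝ :=
  Matrix.of fun μ ν => slicedRicci g (spaceIdx μ) (spaceIdx ν) x ρ

/-- `S_{μ∞}` on `(x, ρ)`-space. -/
def SInf (g : (Fin d → ℝ) → ℝ → Matrix (Fin d) (Fin d) ℝ) (x : Fin d → ℝ) (ρ : ℝ) :
    Fin d → ℝ :=
  fun μ => slicedRicci g (spaceIdx μ) inftyIdx x ρ

/-- `S_{∞∞}` on `(x, ρ)`-space. -/
def SInfInf (g : (Fin d → ℝ) → ℝ → Matrix (Fin d) (Fin d) ℝ) (x : Fin d → ℝ) (ρ : ℝ) : ℝ :=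
  slicedRicci g inftyIdx inftyIdx x ρ

/-- The trace `S = g^{μν} S_{μν}`. -/
def STrace (g : (Fin d → ℝ) → ℝ → Matrix (Fin d) (Fin d) ℝ) (x : Fin d → ℝ) (ρ : ℝ) : ℝ :=
  ∑ μ, ∑ ν, (g x ρ)⁻¹ μ ν * S g x ρ μ ν

/-- `S^{μν} = g^{μξ} g^{νχ} S_{ξχ}`. -/
def SUp (g : (Fin d → ℝ) → ℝ → Matrix (Fin d) (Fin d) ℝ) (x : Fin d → ℝ) (ρ : ℝ)
    (μ ν : Fin d) : ℝ :=
  ∑ ξ, ∑ χ, (g x ρ)⁻¹ μ ξ * (g x ρ)⁻¹ ν χ * S g x ρ ξ χ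

/-- `g'_{μν} = ∂_∞ g_{μν}`, the derivative in `ρ`. -/
def gPrime (g : (Fin d → ℝ) → ℝ → Matrix (Fin d) (Fin d) ℝ) (x : Fin d → ℝ) (ρ : ℝ)
    (μ ν : Fin d) : ℝ :=
  deriv (fun r => g x r μ ν) ρ

/-- `g^{ξχ} g'_{ξχ}`. -/
def trGPrime (g : (Fin d → ℝ) → ℝ → Matrix (Fin d) (Fin d) ℝ) (x : Fin d → ℝ) (ρ : ℝ) : ℝ :=
  ∑ ξ, ∑ χ, (g x ρ)⁻¹ ξ χ * gPrime g x ρ ξ χ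

end Ambient

section Manifold

variable {d : ℕ} {M : Type*} [TopologicalSpace M] [ChartedSpace (EuclideanSpace ℝ (Fin d)) M]

/-- The component `g_{μν}(x, ρ) = g_ρ(∂_μ, ∂_ν)` in the chart `e` of a family `g_ρ` of bilinear
forms on the tangent spaces of `M`. -/
def chartComponents
    (g : (p : M) → ℝ → TangentSpace (𝓡 d) p →L[ℝ] TangentSpace (𝓡 d) p →L[ℝ] ℝ)
    (e : OpenPartialHomeomorph M (EuclideanSpace ℝ (Fin d)))
    (x : Fin d → ℝ) (ρ : ℝ) : Matrix (Fin d) (Fin d) ℝ :=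
  Matrix.of fun μ ν =>
    g (e.symm (WithLp.toLp 2 x)) ρ
      (mfderiv (𝓡 d) (𝓡 d) e.symm (WithLp.toLp 2 x) (EuclideanSpace.single μ (1 : ℝ)))
      (mfderiv (𝓡 d) (𝓡 d) e.symm (WithLp.toLp 2 x) (EuclideanSpace.single ν (1 : ℝ)))

/-- The set of all `(x, ρ)` such that `x` lies in the range of the chart `e` and the point with
coordinates `(x, ρ)` lies in `Ω`. -/
def chartDomain (Ω : Set (M × ℝ)) (e : OpenPartialHomeomorph M (EuclideanSpace ℝ (Fin d))) :
    Set ((Fin d → ℝ) × ℝ) :=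
  {q | WithLp.toLp 2 q.1 ∈ e.target ∧ (e.symm (WithLp.toLp 2 q.1), q.2) ∈ Ω}

/-- On the open set `Ω ⊆ M × ℝ`, `g` is a family of pseudo-Riemannian metrics on `M` that depends
smoothly on the point of `M` and on the parameter `ρ`. -/
structure IsMetricFamilyOn (Ω : Set (M × ℝ))
    (g : (p : M) → ℝ → TangentSpace (𝓡 d) p →L[ℝ] TangentSpace (𝓡 d) p →L[ℝ] ℝ) : Prop where
  isOpen : IsOpen Ω
  symm : ∀ p ρ, (p, ρ) ∈ Ω → ∀ v w, g p ρ v w = g p ρ w v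
  nondegenerate : ∀ p ρ, (p, ρ) ∈ Ω → ∀ v, (∀ w, g p ρ v w = 0) → v = 0
  smooth : ∀ e ∈ IsManifold.maximalAtlas (𝓡 d) ∞ M, ∀ μ ν,
    ContDiffOn ℝ ∞ (fun q : (Fin d → ℝ) × ℝ => chartComponents g e q.1 q.2 μ ν) (chartDomain Ω e)

end Manifold

end AmbientBianchi

end

/-! Both identities are the contracted second Bianchi identity `∇_M R^M_J = ½ ∂_J R` of the ambient
metric, for `J = ν` and `J = ∞`, written out on the slice `t = 1`.

The Bianchi identity (`contracted_bianchi`) is proved for an arbitrary nondegenerate symmetric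
metric, so the signature plays no role. With connection matrices `A_i` and curvature `F_{ij} = ∂_i
A_j - ∂_j A_i + [A_i, A_j]`, the second Bianchi identity is a noncommutative ring computation once
partial derivatives commute. Antisymmetry of `F g⁻¹` expresses that `g⁻¹` is parallel; contracting
twice then gives the divergence of the mixed Ricci tensor.

The variable `t` is removed by homogeneity: every ambient component is a power of `t` times a
function of `(x, ρ)`, the exponent depending only on how often the index `0` occurs, and `∂_t` acts
as multiplication by the exponent (`pd_homogeneous`). On `t = 1` the Christoffel symbols form the
short explicit list of `christoffelTable`. It shows that `T = t ∂_t` satisfies `∇T = id`; hence the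
curvature annihilates `T` and `S_{0J} = 0`, which `gradedRicci_zero_left` checks from the list. The
remaining Ricci components have degree zero in `t`.

Substituting the list and the mixed Ricci components into the Bianchi identity (`graded_bianchi`)
leaves the intrinsic divergence for `g(·, ρ)`, the `ρ`-derivatives and a count of multiples of
`S_{J∞}` that adds up to `d - 2`. -/

set_option linter.unusedSectionVars false

noncomputable section

namespace AmbientBianchi

/-! ### Partial derivatives on coordinate space. -/

section Calculus

variable {ι : Type*} [Fintype ι] [DecidableEq ι]

theorem pd_congr {V : Set (ι → ℝ)} (hV : IsOpen V) {f f' : (ι → ℝ) → ℝ} {x : ι → ℝ} (hx : x ∈ V)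
    (h : ∀ y ∈ V, f y = f' y) (i : ι) : pd i f x = pd i f' x := by
  unfold pd
  rw [Filter.EventuallyEq.fderiv_eq (Filter.eventually_of_mem (hV.mem_nhds hx) h)]

@[simp] theorem pd_const (i : ι) (c : ℝ) (x : ι → ℝ) : pd i (fun _ => c) x = 0 := by
  simp [pd]

theorem pd_add {f f' : (ι → ℝ) → ℝ} {x : ι → ℝ} (hf : DifferentiableAt ℝ f x)
    (hf' : DifferentiableAt ℝ f' x) (i : ι) :
    pd i (fun y => f y + f' y) x = pd i f x + pd i f' x := by
  simp [pd, fderiv_fun_add hf hf']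

theorem pd_neg (f : (ι → ℝ) → ℝ) (x : ι → ℝ) (i : ι) :
    pd i (fun y => -f y) x = -pd i f x := by
  simp [pd, fderiv_fun_neg]

theorem pd_sub {f f' : (ι → ℝ) → ℝ} {x : ι → ℝ} (hf : DifferentiableAt ℝ f x)
    (hf' : DifferentiableAt ℝ f' x) (i : ι) :
    pd i (fun y => f y - f' y) x = pd i f x - pd i f' x := by
  simp [pd, fderiv_fun_sub hf hf']

theorem pd_mul {f f' : (ι → ℝ) → ℝ} {x : ι → ℝ} (hf : DifferentiableAt ℝ f x)
    (hf' : DifferentiableAt ℝ f' x) (i : ι) :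
    pd i (fun y => f y * f' y) x = pd i f x * f' x + f x * pd i f' x := by
  simp [pd, fderiv_fun_mul hf hf']; ring

theorem pd_const_mul (c : ℝ) {f : (ι → ℝ) → ℝ} {x : ι → ℝ} (hf : DifferentiableAt ℝ f x) (i : ι) :
    pd i (fun y => c * f y) x = c * pd i f x := by
  rw [pd_mul (by fun_prop) hf]; simp

theorem pd_sum {α : Type*} (s : Finset α) {f : α → (ι → ℝ) → ℝ} {x : ι → ℝ}
    (hf : ∀ a ∈ s, DifferentiableAt ℝ (f a) x) (i : ι) :
    pd i (fun y => ∑ a ∈ s, f a y) x = ∑ a ∈ s, pd i (f a) x := by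
  simp [pd, fderiv_fun_sum hf]

theorem pd_eq_deriv {f : (ι → ℝ) → ℝ} {x : ι → ℝ} (hf : DifferentiableAt ℝ f x) (i : ι) :
    pd i f x = deriv (fun s => f (Function.update x i s)) (x i) := by
  have h1 : HasDerivAt (Function.update x i) (Pi.single i 1) (x i) := hasDerivAt_update x i (x i)
  have hf' : HasFDerivAt f (fderiv ℝ f x) (Function.update x i (x i)) := by
    rw [Function.update_eq_self]; exact hf.hasFDerivAt
  exact (hf'.comp_hasDerivAt (x i) h1).deriv.symm

theorem contDiffOn_pd {V : Set (ι → ℝ)} (hV : IsOpen V) {f : (ι → ℝ) → ℝ}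
    (hf : ContDiffOn ℝ ∞ f V) (i : ι) : ContDiffOn ℝ ∞ (pd i f) V := by
  have h := hf.fderiv_of_isOpen hV (m := ∞) (by simp)
  exact h.clm_apply contDiffOn_const

theorem differentiableAt_of_contDiffOn {E : Type*} [NormedAddCommGroup E] [NormedSpace ℝ E]
    {V : Set E} (hV : IsOpen V) {f : E → ℝ} (hf : ContDiffOn ℝ ∞ f V) {x : E} (hx : x ∈ V) :
    DifferentiableAt ℝ f x :=
  (hf.contDiffAt (hV.mem_nhds hx)).differentiableAt (by simp)

theorem pd_comm {V : Set (ι → ℝ)} (hV : IsOpen V) {f : (ι → ℝ) → ℝ} (hf : ContDiffOn ℝ ∞ f V)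
    {x : ι → ℝ} (hx : x ∈ V) (i j : ι) : pd i (pd j f) x = pd j (pd i f) x := by
  have hat := hf.contDiffAt (hV.mem_nhds hx)
  have hd : DifferentiableAt ℝ (fderiv ℝ f) x :=
    (hat.fderiv_right (m := ∞) (by simp)).differentiableAt (by simp)
  have key : ∀ i j : ι, pd i (pd j f) x
      = fderiv ℝ (fderiv ℝ f) x (Pi.single i 1) (Pi.single j 1) := by
    intro i j
    unfold pd
    rw [fderiv_clm_apply hd (by fun_prop)]
    simp
  rw [key, key]
  exact (hat.isSymmSndFDerivAt (by simpa using WithTop.coe_le_coe.2 (le_top : (2 : ℕ∞) ≤ ⊤))).eq _ _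

end Calculus

/-! ### Entrywise calculus of matrix-valued functions. -/

section MatrixCalculus

variable {ι : Type*} [Fintype ι] [DecidableEq ι]

/-- The entrywise partial derivative of a matrix-valued function. -/
def pdMatrix (i : ι) (M : (ι → ℝ) → Matrix ι ι ℝ) (x : ι → ℝ) : Matrix ι ι ℝ :=
  Matrix.of fun a b => pd i (fun y => M y a b) x

/-- Entrywise smoothness on a set of a matrix-valued function. -/
def SmoothMatrixOn (V : Set (ι → ℝ)) (M : (ι → ℝ) → Matrix ι ι ℝ) : Prop :=
  ∀ a b, ContDiffOn ℝ ∞ (fun x => M x a b) V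

variable {V : Set (ι → ℝ)} {M N : (ι → ℝ) → Matrix ι ι ℝ} {x : ι → ℝ}

theorem SmoothMatrixOn.mul (hM : SmoothMatrixOn V M) (hN : SmoothMatrixOn V N) :
    SmoothMatrixOn V (fun x => M x * N x) := fun a b => by
  simp only [Matrix.mul_apply]
  exact ContDiffOn.sum fun c _ => (hM a c).mul (hN c b)

theorem SmoothMatrixOn.add (hM : SmoothMatrixOn V M) (hN : SmoothMatrixOn V N) :
    SmoothMatrixOn V (fun x => M x + N x) := fun a b => (hM a b).add (hN a b)

theorem SmoothMatrixOn.sub (hM : SmoothMatrixOn V M) (hN : SmoothMatrixOn V N) :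
    SmoothMatrixOn V (fun x => M x - N x) := fun a b => (hM a b).sub (hN a b)

theorem SmoothMatrixOn.neg (hM : SmoothMatrixOn V M) :
    SmoothMatrixOn V (fun x => -M x) := fun a b => (hM a b).neg

theorem SmoothMatrixOn.transpose (hM : SmoothMatrixOn V M) :
    SmoothMatrixOn V (fun x => (M x).transpose) := fun a b => hM b a

theorem SmoothMatrixOn.pdMatrix (hV : IsOpen V) (hM : SmoothMatrixOn V M) (i : ι) :
    SmoothMatrixOn V (pdMatrix i M) := fun a b => contDiffOn_pd hV (hM a b) i

theorem SmoothMatrixOn.differentiableAt (hV : IsOpen V) (hM : SmoothMatrixOn V M) (hx : x ∈ V)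
    (a b : ι) : DifferentiableAt ℝ (fun y => M y a b) x :=
  differentiableAt_of_contDiffOn hV (hM a b) hx

theorem pdMatrix_congr (hV : IsOpen V) (hx : x ∈ V) (h : ∀ y ∈ V, M y = N y) (i : ι) :
    pdMatrix i M x = pdMatrix i N x := by
  ext a b
  exact pd_congr hV hx (fun y hy => by rw [h y hy]) i

theorem pdMatrix_mul (hV : IsOpen V) (hM : SmoothMatrixOn V M) (hN : SmoothMatrixOn V N)
    (hx : x ∈ V) (i : ι) :
    pdMatrix i (fun y => M y * N y) x = pdMatrix i M x * N x + M x * pdMatrix i N x := by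
  ext a b
  simp only [pdMatrix, Matrix.of_apply, Matrix.mul_apply, Matrix.add_apply]
  rw [pd_sum _ fun c _ => (hM.differentiableAt hV hx a c).fun_mul (hN.differentiableAt hV hx c b),
    ← Finset.sum_add_distrib]
  exact Finset.sum_congr rfl fun c _ =>
    pd_mul (hM.differentiableAt hV hx a c) (hN.differentiableAt hV hx c b) i

theorem pdMatrix_add (hV : IsOpen V) (hM : SmoothMatrixOn V M) (hN : SmoothMatrixOn V N)
    (hx : x ∈ V) (i : ι) :
    pdMatrix i (fun y => M y + N y) x = pdMatrix i M x + pdMatrix i N x := by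
  ext a b
  exact pd_add (hM.differentiableAt hV hx a b) (hN.differentiableAt hV hx a b) i

theorem pdMatrix_sub (hV : IsOpen V) (hM : SmoothMatrixOn V M) (hN : SmoothMatrixOn V N)
    (hx : x ∈ V) (i : ι) :
    pdMatrix i (fun y => M y - N y) x = pdMatrix i M x - pdMatrix i N x := by
  ext a b
  exact pd_sub (hM.differentiableAt hV hx a b) (hN.differentiableAt hV hx a b) i

theorem pdMatrix_neg (i : ι) : pdMatrix i (fun y => -M y) x = -pdMatrix i M x := by
  ext a b
  exact pd_neg _ x i

theorem pdMatrix_transpose (i : ι) :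
    pdMatrix i (fun y => (M y).transpose) x = (pdMatrix i M x).transpose := rfl

theorem pdMatrix_comm (hV : IsOpen V) (hM : SmoothMatrixOn V M) (hx : x ∈ V) (i j : ι) :
    pdMatrix i (pdMatrix j M) x = pdMatrix j (pdMatrix i M) x := by
  ext a b
  exact pd_comm hV (hM a b) hx i j

theorem contDiffOn_det (hM : SmoothMatrixOn V M) : ContDiffOn ℝ ∞ (fun x => (M x).det) V := by
  simp only [Matrix.det_apply']
  exact ContDiffOn.sum fun σ _ => contDiffOn_const.mul (contDiffOn_prod fun i _ => hM _ _)

/-- Cramer's rule: an entry of the inverse is a quotient of determinants, which are polynomials in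
smooth entries. -/
theorem SmoothMatrixOn.inv (hM : SmoothMatrixOn V M) (hdet : ∀ x ∈ V, (M x).det ≠ 0) :
    SmoothMatrixOn V (fun x => (M x)⁻¹) := fun a b => by
  have h : ∀ x ∈ V, (M x)⁻¹ a b
      = (M x).det⁻¹ * ((M x).updateRow b (Pi.single a 1)).det := fun x _ => by
    rw [Matrix.inv_def, Matrix.smul_apply, Matrix.adjugate_apply, smul_eq_mul, Ring.inverse_eq_inv']
  refine ContDiffOn.congr (ContDiffOn.mul ((contDiffOn_det hM).inv hdet) (contDiffOn_det ?_)) h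
  intro c e
  by_cases hcb : c = b
  · subst hcb
    simpa [Matrix.updateRow_self] using contDiffOn_const
  · simpa [Matrix.updateRow_ne hcb] using hM c e

end MatrixCalculus

/-! ### Connection and curvature matrices, second Bianchi identity, symmetry of Ricci. -/

section Bianchi

open Matrix

variable {ι : Type*} [Fintype ι] [DecidableEq ι]

/-- On the open set `V`, `g` is a smooth field of nondegenerate symmetric matrices. -/
structure IsSmoothMetricOn (V : Set (ι → ℝ)) (g : (ι → ℝ) → Matrix ι ι ℝ) : Prop where
  isOpen : IsOpen V
  symm : ∀ x ∈ V, (g x)ᵀ = g x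
  det_ne_zero : ∀ x ∈ V, (g x).det ≠ 0
  smooth : SmoothMatrixOn V g

/-- The connection matrix `(A_i)^l_k = Γ^l_{ik}`. -/
def connMatrix (g : (ι → ℝ) → Matrix ι ι ℝ) (i : ι) (x : ι → ℝ) : Matrix ι ι ℝ :=
  Matrix.of fun l k => christoffel g l i k x

/-- The curvature matrix `F_{ij} = ∂_i A_j - ∂_j A_i + [A_i, A_j]`. -/
def curvMatrix (g : (ι → ℝ) → Matrix ι ι ℝ) (i j : ι) (x : ι → ℝ) : Matrix ι ι ℝ :=
  pdMatrix i (connMatrix g j) x - pdMatrix j (connMatrix g i) x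
    + connMatrix g i x * connMatrix g j x - connMatrix g j x * connMatrix g i x

/-- The mixed Ricci tensor `R^k_j = g^{ka} R_{aj}`. -/
def mixedRicci (g : (ι → ℝ) → Matrix ι ι ℝ) (x : ι → ℝ) (k j : ι) : ℝ :=
  ∑ a, (g x)⁻¹ k a * ricci g a j x

variable {V : Set (ι → ℝ)} {g : (ι → ℝ) → Matrix ι ι ℝ} {x : ι → ℝ}

theorem curvMatrix_swap (i j : ι) : curvMatrix g j i x = -curvMatrix g i j x := by
  simp only [curvMatrix]
  abel

namespace IsSmoothMetricOn

variable (hg : IsSmoothMetricOn V g)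
include hg

theorem inv_mul (hx : x ∈ V) : (g x)⁻¹ * g x = 1 :=
  Matrix.nonsing_inv_mul _ (isUnit_iff_ne_zero.2 (hg.det_ne_zero x hx))

theorem mul_inv (hx : x ∈ V) : g x * (g x)⁻¹ = 1 :=
  Matrix.mul_nonsing_inv _ (isUnit_iff_ne_zero.2 (hg.det_ne_zero x hx))

theorem inv_symm (hx : x ∈ V) : ((g x)⁻¹)ᵀ = (g x)⁻¹ := by
  rw [Matrix.transpose_nonsing_inv, hg.symm x hx]

theorem apply_comm (hx : x ∈ V) (i j : ι) : g x i j = g x j i :=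
  congrFun (congrFun (hg.symm x hx) j) i

theorem inv_apply_comm (hx : x ∈ V) (i j : ι) : (g x)⁻¹ i j = (g x)⁻¹ j i :=
  congrFun (congrFun (hg.inv_symm hx) j) i

theorem pd_apply_comm (hx : x ∈ V) (k i j : ι) :
    pd k (fun y => g y i j) x = pd k (fun y => g y j i) x :=
  pd_congr hg.isOpen hx (fun _ hy => hg.apply_comm hy i j) k

theorem smooth_inv : SmoothMatrixOn V (fun x => (g x)⁻¹) := hg.smooth.inv hg.det_ne_zero

theorem smooth_christoffel (k i j : ι) : ContDiffOn ℝ ∞ (christoffel g k i j) V := by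
  refine contDiffOn_const.mul (ContDiffOn.sum fun l _ => (hg.smooth_inv k l).mul ?_)
  exact ((contDiffOn_pd hg.isOpen (hg.smooth l j) i).add
    (contDiffOn_pd hg.isOpen (hg.smooth l i) j)).sub (contDiffOn_pd hg.isOpen (hg.smooth i j) l)

theorem smooth_connMatrix (i : ι) : SmoothMatrixOn V (connMatrix g i) :=
  fun a b => hg.smooth_christoffel a i b

theorem christoffel_comm (hx : x ∈ V) (k i j : ι) :
    christoffel g k i j x = christoffel g k j i x := by
  unfold christoffel
  congr 1
  refine Finset.sum_congr rfl fun l _ => ?_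
  rw [hg.pd_apply_comm hx l i j]
  ring

theorem mul_connMatrix_apply (hx : x ∈ V) (i j k : ι) : (g x * connMatrix g i x) j k
    = 1 / 2 * (pd i (fun y => g y j k) x + pd k (fun y => g y j i) x
      - pd j (fun y => g y i k) x) := by
  have h : connMatrix g i x = (1 / 2 : ℝ) • ((g x)⁻¹ * Matrix.of fun l k =>
      (pd i (fun y => g y l k) x + pd k (fun y => g y l i) x - pd l (fun y => g y i k) x)) := by
    ext l k
    simp [connMatrix, christoffel, Matrix.mul_apply]
  rw [h, Matrix.mul_smul, ← Matrix.mul_assoc, hg.mul_inv hx, Matrix.one_mul]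
  simp

/-- Metric compatibility. Lowering the upper index of `A_i` leaves the Koszul expression, whose part
antisymmetric in the outer indices cancels on adding the transpose. -/
theorem pdMatrix_metric (hx : x ∈ V) (i : ι) :
    pdMatrix i g x = (connMatrix g i x)ᵀ * g x + g x * connMatrix g i x := by
  have h : (connMatrix g i x)ᵀ * g x = (g x * connMatrix g i x)ᵀ := by
    rw [Matrix.transpose_mul, hg.symm x hx]
  ext j k
  rw [h, Matrix.add_apply, Matrix.transpose_apply, hg.mul_connMatrix_apply hx,
    hg.mul_connMatrix_apply hx, hg.pd_apply_comm hx i k j, hg.pd_apply_comm hx k j i,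
    hg.pd_apply_comm hx j k i]
  simp only [pdMatrix, Matrix.of_apply]
  ring

/-- Obtained by differentiating `g g⁻¹ = 1` and using metric compatibility; this says that `g⁻¹` is
parallel. -/
theorem pdMatrix_inv (hx : x ∈ V) (i : ι) : pdMatrix i (fun y => (g y)⁻¹) x
    = -(connMatrix g i x * (g x)⁻¹) - (g x)⁻¹ * (connMatrix g i x)ᵀ := by
  have h1 : pdMatrix i (fun y => g y * (g y)⁻¹) x = 0 := by
    rw [pdMatrix_congr hg.isOpen hx (N := fun _ => 1) (fun y hy => hg.mul_inv hy)]
    ext a b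
    simp [pdMatrix]
  rw [pdMatrix_mul hg.isOpen hg.smooth hg.smooth_inv hx, hg.pdMatrix_metric hx] at h1
  have h2 := congrArg (fun M => (g x)⁻¹ * M) h1
  simp only [Matrix.mul_add, Matrix.add_mul, Matrix.mul_zero, ← Matrix.mul_assoc,
    hg.inv_mul hx, Matrix.one_mul] at h2
  rw [Matrix.mul_assoc _ (g x), hg.mul_inv hx, Matrix.mul_one] at h2
  rw [← sub_eq_zero, ← h2]
  abel

/-- The integrability condition of `∇ g⁻¹ = 0`: expanding both orders of the mixed second derivative
of `g⁻¹` and subtracting leaves exactly the action of the curvature on `g⁻¹`. -/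
theorem curvMatrix_antisymm (hx : x ∈ V) (i j : ι) :
    curvMatrix g i j x * (g x)⁻¹ + (g x)⁻¹ * (curvMatrix g i j x)ᵀ = 0 := by
  have hA := hg.smooth_connMatrix
  have hh := hg.smooth_inv
  have key : ∀ i j : ι, pdMatrix i (pdMatrix j fun y => (g y)⁻¹) x
      = -(pdMatrix i (connMatrix g j) x * (g x)⁻¹
          + connMatrix g j x * (-(connMatrix g i x * (g x)⁻¹) - (g x)⁻¹ * (connMatrix g i x)ᵀ))
        - ((-(connMatrix g i x * (g x)⁻¹) - (g x)⁻¹ * (connMatrix g i x)ᵀ) * (connMatrix g j x)ᵀ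
          + (g x)⁻¹ * (pdMatrix i (connMatrix g j) x)ᵀ) := by
    intro i j
    rw [pdMatrix_congr hg.isOpen hx (fun y hy => hg.pdMatrix_inv hy j),
      pdMatrix_sub hg.isOpen ((hA j).mul hh).neg (hh.mul (hA j).transpose) hx,
      pdMatrix_neg, pdMatrix_mul hg.isOpen (hA j) hh hx,
      pdMatrix_mul hg.isOpen hh (hA j).transpose hx, hg.pdMatrix_inv hx i, pdMatrix_transpose]
  have hc := pdMatrix_comm hg.isOpen hh hx i j
  rw [key, key] at hc
  rw [← sub_eq_zero] at hc
  rw [← neg_eq_zero, ← hc]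
  simp only [curvMatrix, Matrix.transpose_add, Matrix.transpose_sub, Matrix.transpose_mul]
  noncomm_ring

theorem smooth_curvMatrix (i j : ι) : SmoothMatrixOn V (curvMatrix g i j) :=
  ((((hg.smooth_connMatrix j).pdMatrix hg.isOpen i).sub
    ((hg.smooth_connMatrix i).pdMatrix hg.isOpen j)).add
      ((hg.smooth_connMatrix i).mul (hg.smooth_connMatrix j))).sub
        ((hg.smooth_connMatrix j).mul (hg.smooth_connMatrix i))

theorem pdMatrix_curvMatrix (hx : x ∈ V) (m i j : ι) : pdMatrix m (curvMatrix g i j) x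
    = pdMatrix m (pdMatrix i (connMatrix g j)) x - pdMatrix m (pdMatrix j (connMatrix g i)) x
      + (pdMatrix m (connMatrix g i) x * connMatrix g j x
        + connMatrix g i x * pdMatrix m (connMatrix g j) x)
      - (pdMatrix m (connMatrix g j) x * connMatrix g i x
        + connMatrix g j x * pdMatrix m (connMatrix g i) x) := by
  have hA := hg.smooth_connMatrix
  have h1 := (hA j).pdMatrix hg.isOpen i
  have h2 := (hA i).pdMatrix hg.isOpen j
  rw [show curvMatrix g i j = fun y => pdMatrix i (connMatrix g j) y - pdMatrix j (connMatrix g i) y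
    + connMatrix g i y * connMatrix g j y - connMatrix g j y * connMatrix g i y from rfl,
    pdMatrix_sub hg.isOpen ((h1.sub h2).add ((hA i).mul (hA j))) ((hA j).mul (hA i)) hx,
    pdMatrix_add hg.isOpen (h1.sub h2) ((hA i).mul (hA j)) hx,
    pdMatrix_sub hg.isOpen h1 h2 hx, pdMatrix_mul hg.isOpen (hA i) (hA j) hx,
    pdMatrix_mul hg.isOpen (hA j) (hA i) hx]

/-- The second Bianchi identity with raised index. -/
theorem second_bianchi (hx : x ∈ V) (m i j : ι) :
    (pdMatrix m (fun y => curvMatrix g i j y * (g y)⁻¹) x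
      + connMatrix g m x * (curvMatrix g i j x * (g x)⁻¹)
      + curvMatrix g i j x * (g x)⁻¹ * (connMatrix g m x)ᵀ)
    + (pdMatrix i (fun y => curvMatrix g j m y * (g y)⁻¹) x
      + connMatrix g i x * (curvMatrix g j m x * (g x)⁻¹)
      + curvMatrix g j m x * (g x)⁻¹ * (connMatrix g i x)ᵀ)
    + (pdMatrix j (fun y => curvMatrix g m i y * (g y)⁻¹) x
      + connMatrix g j x * (curvMatrix g m i x * (g x)⁻¹)
      + curvMatrix g m i x * (g x)⁻¹ * (connMatrix g j x)ᵀ) = 0 := by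
  have hA := hg.smooth_connMatrix
  -- Since `g⁻¹` is parallel, each bracket equals `(∂_m F_{ij} + [A_m, F_{ij}]) g⁻¹`. In the cyclic
  -- sum the second derivatives of `A` cancel by commutation and the rest by the Jacobi identity.
  rw [pdMatrix_mul hg.isOpen (hg.smooth_curvMatrix i j) hg.smooth_inv hx,
    pdMatrix_mul hg.isOpen (hg.smooth_curvMatrix j m) hg.smooth_inv hx,
    pdMatrix_mul hg.isOpen (hg.smooth_curvMatrix m i) hg.smooth_inv hx,
    hg.pdMatrix_inv hx, hg.pdMatrix_inv hx, hg.pdMatrix_inv hx, hg.pdMatrix_curvMatrix hx,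
    hg.pdMatrix_curvMatrix hx, hg.pdMatrix_curvMatrix hx,
    pdMatrix_comm hg.isOpen (hA j) hx m i, pdMatrix_comm hg.isOpen (hA i) hx m j,
    pdMatrix_comm hg.isOpen (hA m) hx i j]
  simp only [curvMatrix]
  noncomm_ring

theorem sum_curvMatrix (hx : x ∈ V) (k j : ι) : ∑ i, curvMatrix g i j x i k = ricci g k j x := by
  simp only [curvMatrix, ricci, Matrix.sub_apply, Matrix.add_apply, Matrix.mul_apply,
    Finset.sum_sub_distrib, Finset.sum_add_distrib, pdMatrix, connMatrix, Matrix.of_apply]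
  have h1 : ∀ a b c e, pd a (christoffel g b c e) x = pd a (christoffel g b e c) x :=
    fun a b c e => pd_congr hg.isOpen hx (fun y hy => hg.christoffel_comm hy b c e) a
  congr 1
  · congr 1
    · congr 1
      · exact Finset.sum_congr rfl fun i _ => h1 _ _ _ _
      · exact Finset.sum_congr rfl fun i _ => h1 _ _ _ _
    · exact Finset.sum_congr rfl fun i _ => Finset.sum_congr rfl fun l _ => by
        rw [hg.christoffel_comm hx l j k]
  · exact Finset.sum_congr rfl fun i _ => Finset.sum_congr rfl fun l _ => by
      rw [hg.christoffel_comm hx l i k]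

/-- For a symmetric connection the only possible asymmetry of Ricci is `∂_i Γ^k_{jk} - ∂_j
Γ^k_{ik}`, the trace of `F_{ij}`. This trace vanishes because `F_{ij}` is conjugate by `g` to minus
its transpose. -/
theorem ricci_comm (hx : x ∈ V) (i j : ι) : ricci g i j x = ricci g j i x := by
  have hanti := hg.curvMatrix_antisymm hx i j
  have h1 : curvMatrix g i j x = -((g x)⁻¹ * (curvMatrix g i j x)ᵀ * g x) := by
    have h2 := congrArg (fun M => M * g x) hanti
    simp only [Matrix.add_mul, Matrix.zero_mul] at h2
    rw [Matrix.mul_assoc, hg.inv_mul hx, Matrix.mul_one] at h2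
    exact eq_neg_of_add_eq_zero_left h2
  have htr : (curvMatrix g i j x).trace = 0 := by
    have h3 := congrArg Matrix.trace h1
    rw [Matrix.trace_neg, Matrix.mul_assoc, Matrix.trace_mul_comm, Matrix.mul_assoc,
      hg.mul_inv hx, Matrix.mul_one, Matrix.trace_transpose] at h3
    linarith
  have h4 : (curvMatrix g i j x).trace
      = ∑ k, pd i (christoffel g k j k) x - ∑ k, pd j (christoffel g k i k) x := by
    rw [curvMatrix, Matrix.trace_sub, Matrix.trace_add, Matrix.trace_sub,
      Matrix.trace_mul_comm (connMatrix g i x)]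
    simp [Matrix.trace, pdMatrix, connMatrix]
  have h5 : ∑ k, ∑ l, christoffel g k j l x * christoffel g l i k x
      = ∑ k, ∑ l, christoffel g k i l x * christoffel g l j k x := by
    rw [Finset.sum_comm]
    exact Finset.sum_congr rfl fun _ _ => Finset.sum_congr rfl fun _ _ => mul_comm _ _
  have h6 : ∑ k, pd k (christoffel g k i j) x = ∑ k, pd k (christoffel g k j i) x :=
    Finset.sum_congr rfl fun k _ =>
      pd_congr hg.isOpen hx (fun y hy => hg.christoffel_comm hy k i j) k
  have h7 : ∑ k, ∑ l, christoffel g k k l x * christoffel g l i j x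
      = ∑ k, ∑ l, christoffel g k k l x * christoffel g l j i x :=
    Finset.sum_congr rfl fun k _ => Finset.sum_congr rfl fun l _ => by
      rw [hg.christoffel_comm hx l i j]
  unfold ricci
  linarith

end IsSmoothMetricOn

end Bianchi

/-! ### Contracted Bianchi identity and divergence formulas. -/

section Contraction

open Matrix

variable {ι : Type*} [Fintype ι] [DecidableEq ι]

/-- Double contraction of an identity of second Bianchi type. -/
theorem contract_bianchi {Γ : ι → ι → ι → ℝ} {w : ι → ι → ι → ι → ℝ}
    {dw : ι → ι → ι → ι → ι → ℝ} {Q : ι → ι → ℝ} {dQ : ι → ι → ι → ℝ}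
    (hΓ : ∀ k i j, Γ k i j = Γ k j i)
    (hw : ∀ i j l k, w i j l k = -w j i l k) (hw' : ∀ i j l k, w i j l k = -w i j k l)
    (hdw : ∀ m i j l k, dw m i j l k = -dw m j i l k)
    (hdw' : ∀ m i j l k, dw m i j l k = -dw m i j k l)
    (hQ : ∀ k j, Q k j = ∑ l, w l j l k) (hdQ : ∀ m k j, dQ m k j = ∑ l, dw m l j l k)
    (hB : ∀ m i j l k,
      (dw m i j l k + ∑ a, Γ l m a * w i j a k + ∑ a, w i j l a * Γ k m a)
      + (dw i j m l k + ∑ a, Γ l i a * w j m a k + ∑ a, w j m l a * Γ k i a)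
      + (dw j m i l k + ∑ a, Γ l j a * w m i a k + ∑ a, w m i l a * Γ k j a) = 0) (j : ι) :
    ∑ m, dQ m m j + ∑ m, ∑ a, Γ m m a * Q a j - ∑ i, ∑ a, Γ i j a * Q a i
      = 1 / 2 * ∑ k, dQ j k k := by
  have hanti : ∀ u v : ι → ι → ℝ, (∀ a b, u a b = u b a) → (∀ a b, v a b = -v b a) →
      ∑ a, ∑ b, u a b * v a b = 0 := by
    intro u v hu hv
    have h1 : ∑ a, ∑ b, u a b * v a b = -∑ a, ∑ b, u a b * v a b := by
      conv_lhs => rw [Finset.sum_comm]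
      simp only [← Finset.sum_neg_distrib]
      exact Finset.sum_congr rfl fun a _ => Finset.sum_congr rfl fun b _ => by
        rw [hu b a, hv b a]; ring
    linarith
  have s1 : ∑ m, ∑ i, dw m i j i m = ∑ m, dQ m m j := by simp only [hdQ]
  have s2 : ∑ m, ∑ i, ∑ a, Γ i m a * w i j a m = 0 := by
    rw [Finset.sum_comm]
    exact Finset.sum_eq_zero fun i _ =>
      hanti (fun m a => Γ i m a) (fun m a => w i j a m) (fun _ _ => hΓ _ _ _) (fun _ _ => hw' _ _ _ _)
  have s3 : ∑ m, ∑ i, ∑ a, w i j i a * Γ m m a = ∑ m, ∑ a, Γ m m a * Q a j := by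
    refine Finset.sum_congr rfl fun m _ => ?_
    rw [Finset.sum_comm]
    refine Finset.sum_congr rfl fun a _ => ?_
    rw [hQ, ← Finset.sum_mul, mul_comm]
  have s4 : ∑ m, ∑ i, dw i j m i m = ∑ m, dQ m m j := by
    rw [Finset.sum_comm]
    simp only [hdQ]
    exact Finset.sum_congr rfl fun i _ => Finset.sum_congr rfl fun m _ => by
      rw [hdw, hdw', neg_neg]
  have s5 : ∑ m, ∑ i, ∑ a, Γ i i a * w j m a m = ∑ m, ∑ a, Γ m m a * Q a j := by
    rw [Finset.sum_comm]
    refine Finset.sum_congr rfl fun i _ => ?_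
    rw [Finset.sum_comm]
    refine Finset.sum_congr rfl fun a _ => ?_
    rw [hQ, Finset.mul_sum]
    exact Finset.sum_congr rfl fun m _ => by rw [hw j m, hw' m j, neg_neg]
  have s6 : ∑ m, ∑ i, ∑ a, w j m i a * Γ m i a = 0 :=
    Finset.sum_eq_zero fun m _ => by
      simp only [mul_comm (w _ _ _ _)]
      exact hanti (fun i a => Γ m i a) (fun i a => w j m i a) (fun _ _ => hΓ _ _ _)
        (fun _ _ => hw' _ _ _ _)
  have s7 : ∑ m, ∑ i, dw j m i i m = -∑ m, dQ j m m := by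
    simp only [hdQ, ← Finset.sum_neg_distrib]
    exact Finset.sum_congr rfl fun m _ => Finset.sum_congr rfl fun i _ => hdw _ _ _ _ _
  have s8 : ∑ m, ∑ i, ∑ a, Γ i j a * w m i a m = -∑ i, ∑ a, Γ i j a * Q a i := by
    rw [Finset.sum_comm]
    simp only [← Finset.sum_neg_distrib]
    refine Finset.sum_congr rfl fun i _ => ?_
    rw [Finset.sum_comm]
    refine Finset.sum_congr rfl fun a _ => ?_
    rw [hQ, Finset.mul_sum, ← Finset.sum_neg_distrib]
    exact Finset.sum_congr rfl fun m _ => by rw [hw' m i a]; ring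
  have s9 : ∑ m, ∑ i, ∑ a, w m i i a * Γ m j a = -∑ i, ∑ a, Γ i j a * Q a i := by
    simp only [← Finset.sum_neg_distrib]
    refine Finset.sum_congr rfl fun m _ => ?_
    rw [Finset.sum_comm]
    refine Finset.sum_congr rfl fun a _ => ?_
    rw [hQ, Finset.mul_sum, ← Finset.sum_neg_distrib]
    exact Finset.sum_congr rfl fun i _ => by rw [hw m i]; ring
  -- The contraction is `l = i`, `k = m`. The first two cyclic terms each give the divergence part
  -- of `Q`; the third gives minus the derivative of the trace together with two copies of the
  -- correction `-Γ Q`. In `s2` and `s6` a symmetric `Γ` meets an antisymmetric `w`. Halving the sum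
  -- gives the claim.
  have hsum := Finset.sum_eq_zero (s := Finset.univ) fun m _ =>
    Finset.sum_eq_zero (s := Finset.univ) fun i _ => hB m i j i m
  simp only [Finset.sum_add_distrib] at hsum
  rw [s1, s2, s3, s4, s5, s6, s7, s8, s9] at hsum
  linarith

variable {V : Set (ι → ℝ)} {g : (ι → ℝ) → Matrix ι ι ℝ} {x : ι → ℝ}

namespace IsSmoothMetricOn

variable (hg : IsSmoothMetricOn V g)
include hg

theorem mixedRicci_eq_sum (hx : x ∈ V) (k j : ι) :
    mixedRicci g x k j = ∑ l, (curvMatrix g l j x * (g x)⁻¹) l k := by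
  simp only [mixedRicci, Matrix.mul_apply]
  rw [Finset.sum_comm]
  refine Finset.sum_congr rfl fun a _ => ?_
  rw [← Finset.sum_mul, hg.sum_curvMatrix hx, hg.inv_apply_comm hx k a, mul_comm]

/-- The contracted second Bianchi identity `∇_m R^m_j = ½ ∂_j R`. -/
theorem contracted_bianchi (hx : x ∈ V) (j : ι) :
    ∑ m, pd m (fun y => mixedRicci g y m j) x
      + ∑ m, ∑ a, christoffel g m m a x * mixedRicci g x a j
      - ∑ i, ∑ a, christoffel g i j a x * mixedRicci g x a i
      = 1 / 2 * ∑ k, pd j (fun y => mixedRicci g y k k) x := by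
  have hsm : ∀ i j, SmoothMatrixOn V (fun y => curvMatrix g i j y * (g y)⁻¹) := fun i j =>
    (hg.smooth_curvMatrix i j).mul hg.smooth_inv
  have hw : ∀ y, ∀ i j l k,
      (curvMatrix g i j y * (g y)⁻¹) l k = -(curvMatrix g j i y * (g y)⁻¹) l k := by
    intro y i j l k
    rw [curvMatrix_swap j i, Matrix.neg_mul, Matrix.neg_apply]
  have hw' : ∀ y ∈ V, ∀ i j l k,
      (curvMatrix g i j y * (g y)⁻¹) l k = -(curvMatrix g i j y * (g y)⁻¹) k l := by
    intro y hy i j l k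
    have h := congrFun (congrFun (hg.curvMatrix_antisymm hy i j) l) k
    rw [← hg.inv_symm hy, ← Matrix.transpose_mul, hg.inv_symm hy] at h
    exact eq_neg_of_add_eq_zero_left h
  refine contract_bianchi (Γ := fun k i j => christoffel g k i j x)
    (w := fun i j l k => (curvMatrix g i j x * (g x)⁻¹) l k)
    (dw := fun m i j l k => pd m (fun y => (curvMatrix g i j y * (g y)⁻¹) l k) x)
    (Q := mixedRicci g x) (dQ := fun m k j => pd m (fun y => mixedRicci g y k j) x)
    (fun k i j => hg.christoffel_comm hx k i j) (hw x) (hw' x hx) ?_ ?_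
    (hg.mixedRicci_eq_sum hx) ?_ ?_ j
  · intro m i j l k
    rw [← pd_neg]
    exact pd_congr hg.isOpen hx (fun y _ => hw y i j l k) m
  · intro m i j l k
    rw [← pd_neg]
    exact pd_congr hg.isOpen hx (fun y hy => hw' y hy i j l k) m
  · intro m k j
    rw [pd_congr hg.isOpen hx (fun y hy => hg.mixedRicci_eq_sum hy k j) m]
    exact pd_sum _ (fun l _ => (hsm l j).differentiableAt hg.isOpen hx l k) m
  · intro m i j l k
    exact congrFun (congrFun (hg.second_bianchi hx m i j) l) k

/-- The divergence of a one-form in terms of the vector field with raised index. -/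
theorem div₁_eq (hx : x ∈ V) {θ : (ι → ℝ) → ι → ℝ}
    (hθ : ∀ i, DifferentiableAt ℝ (fun y => θ y i) x) :
    div₁ g θ x = ∑ m, pd m (fun y => ∑ b, (g y)⁻¹ m b * θ y b) x
      + ∑ m, ∑ a, christoffel g m m a x * ∑ b, (g x)⁻¹ a b * θ x b := by
  have hd := fun a b => hg.smooth_inv.differentiableAt hg.isOpen hx a b
  -- The derivative of `g⁻¹` produces two connection terms: one is the correction inside `∇θ`, the
  -- other cancels the trace term `Γ^m_{ma} θ^a`.
  have h1 : ∀ m, pd m (fun y => ∑ b, (g y)⁻¹ m b * θ y b) x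
      = ∑ b, (g x)⁻¹ m b * pd m (fun y => θ y b) x
        - ∑ b, ∑ a, (g x)⁻¹ m a * christoffel g b m a x * θ x b
        - ∑ a, christoffel g m m a x * ∑ b, (g x)⁻¹ a b * θ x b := by
    intro m
    have h2 : ∀ b, pd m (fun y => (g y)⁻¹ m b) x
        = -(∑ a, christoffel g m m a x * (g x)⁻¹ a b)
          - ∑ a, (g x)⁻¹ m a * christoffel g b m a x :=
      fun b => congrFun (congrFun (hg.pdMatrix_inv hx m) m) b
    have h3 : ∑ a, christoffel g m m a x * ∑ b, (g x)⁻¹ a b * θ x b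
        = ∑ b, (∑ a, christoffel g m m a x * (g x)⁻¹ a b) * θ x b := by
      simp only [Finset.mul_sum, Finset.sum_mul]
      rw [Finset.sum_comm]
      simp only [mul_assoc]
    rw [pd_sum _ (fun b _ => (hd m b).fun_mul (hθ b)), h3, ← Finset.sum_sub_distrib,
      ← Finset.sum_sub_distrib]
    refine Finset.sum_congr rfl fun b _ => ?_
    rw [pd_mul (hd m b) (hθ b), h2, ← Finset.sum_mul]
    ring
  simp only [h1, Finset.sum_sub_distrib, div₁, covDeriv₁, mul_sub, sub_add_cancel]
  congr 1
  · rw [Finset.sum_comm]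
    exact Finset.sum_congr rfl fun m _ => Finset.sum_congr rfl fun b _ => by
      rw [hg.inv_apply_comm hx b m]
  · refine Finset.sum_congr rfl fun m _ => ?_
    rw [Finset.sum_comm]
    refine Finset.sum_congr rfl fun b _ => ?_
    rw [Finset.mul_sum]
    exact Finset.sum_congr rfl fun a _ => by rw [hg.christoffel_comm hx a m b, mul_assoc]

/-- The divergence of a two-tensor in terms of the tensor with first index raised. -/
theorem div₂_eq (hx : x ∈ V) {T : (ι → ℝ) → Matrix ι ι ℝ}
    (hT : ∀ i j, DifferentiableAt ℝ (fun y => T y i j) x) (j : ι) :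
    div₂ g T j x = ∑ m, pd m (fun y => ∑ b, (g y)⁻¹ m b * T y b j) x
      + ∑ m, ∑ a, christoffel g m m a x * (∑ b, (g x)⁻¹ a b * T x b j)
      - ∑ i, ∑ a, christoffel g i j a x * ∑ b, (g x)⁻¹ a b * T x b i := by
  -- For fixed `j` the column `T_{·j}` is treated as a one-form; only the correction for the second
  -- index is then left to match.
  rw [← hg.div₁_eq hx (fun i => hT i j)]
  simp only [div₂, div₁, covDeriv₂, covDeriv₁]
  rw [← sub_eq_zero, sub_sub_eq_add_sub, add_sub_right_comm, ← Finset.sum_sub_distrib]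
  simp only [← Finset.sum_sub_distrib, ← mul_sub]
  rw [add_eq_zero_iff_eq_neg, ← Finset.sum_neg_distrib]
  simp only [sub_sub_cancel_left, mul_neg, Finset.sum_neg_distrib, neg_inj, Finset.mul_sum]
  have h : ∀ i k l, (g x)⁻¹ i k * (christoffel g l k j x * T x i l)
      = christoffel g l j k x * ((g x)⁻¹ k i * T x i l) := fun i k l => by
    rw [hg.inv_apply_comm hx i k, hg.christoffel_comm hx l k j]
    ring
  simp only [h]
  rw [Finset.sum_comm' (t' := Finset.univ) (s' := fun _ => Finset.univ) (by simp)]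
  rw [Finset.sum_comm (s := Finset.univ) (t := Finset.univ)
    (f := fun i a => ∑ b, christoffel g i j a x * ((g x)⁻¹ a b * T x b i))]
  exact Finset.sum_congr rfl fun a _ => Finset.sum_comm

end IsSmoothMetricOn

end Contraction

/-! ### Functions homogeneous in `t` on the ambient space. -/

section Graded

variable {d : ℕ}

theorem sum_ambientIndex (f : AmbientIndex d → ℝ) :
    ∑ K, f K = f zeroIdx + ((∑ μ, f (spaceIdx μ)) + f inftyIdx) := by
  rw [Fintype.sum_sum_type, Fintype.sum_sum_type]
  simp

/-- The weight of an ambient index: `1` for `t`, and `0` for `x^μ` and `ρ`. -/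
def weight : AmbientIndex d → ℤ
  | Sum.inl _ => 1
  | Sum.inr _ => 0

/-- The derivative of `t ^ n * F (x, ρ)` in the direction of an ambient index, on `t = 1`. -/
def gradedPd (I : AmbientIndex d) (n : ℤ) (F : (Fin d → ℝ) → ℝ → ℝ) (x : Fin d → ℝ) (ρ : ℝ) : ℝ :=
  match I with
  | Sum.inl _ => n * F x ρ
  | Sum.inr (Sum.inl μ) => pd μ (fun y => F y ρ) x
  | Sum.inr (Sum.inr _) => deriv (fun r => F x r) ρ

/-- The function `t ^ n * F (x, ρ)` on the ambient space. -/
def homogeneous (n : ℤ) (F : (Fin d → ℝ) → ℝ → ℝ) (X : AmbientIndex d → ℝ) : ℝ :=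
  X zeroIdx ^ n * F (fun i => X (spaceIdx i)) (X inftyIdx)

/-- The set of all `(t, x, ρ)` with `t > 0` and `(x, ρ) ∈ U`. -/
def ambientDomain (U : Set ((Fin d → ℝ) × ℝ)) : Set (AmbientIndex d → ℝ) :=
  {X | 0 < X zeroIdx ∧ ((fun i => X (spaceIdx i)), X inftyIdx) ∈ U}

/-- Joint smoothness in `(x, ρ)`. -/
def SmoothFamilyOn (U : Set ((Fin d → ℝ) × ℝ)) (F : (Fin d → ℝ) → ℝ → ℝ) : Prop :=
  ContDiffOn ℝ ∞ (fun q : (Fin d → ℝ) × ℝ => F q.1 q.2) U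

variable {U : Set ((Fin d → ℝ) × ℝ)} {F : (Fin d → ℝ) → ℝ → ℝ} {X : AmbientIndex d → ℝ}

theorem contDiff_spaceProj :
    ContDiff ℝ ∞ fun X : AmbientIndex d → ℝ => ((fun i => X (spaceIdx i)), X inftyIdx) := by
  fun_prop

theorem isOpen_ambientDomain (hU : IsOpen U) : IsOpen (ambientDomain U) :=
  (isOpen_lt continuous_const (continuous_apply _)).inter
    (hU.preimage contDiff_spaceProj.continuous)

theorem contDiffOn_homogeneous (hF : SmoothFamilyOn U F) (n : ℤ) :
    ContDiffOn ℝ ∞ (homogeneous n F) (ambientDomain U) := by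
  intro X hX
  refine ContDiffWithinAt.mul ?_ ?_
  · have h : ContDiffAt ℝ ∞ (fun s : ℝ => s ^ n) (X zeroIdx) := by
      rcases n with n | n
      · simpa using contDiffAt_id.pow n
      · simp only [zpow_negSucc]
        exact (contDiffAt_id.pow (n + 1)).inv (pow_ne_zero _ hX.1.ne')
    exact (ContDiffAt.comp X (f := fun Y : AmbientIndex d → ℝ => Y zeroIdx) h
      (by fun_prop)).contDiffWithinAt
  · exact ContDiffWithinAt.comp X
      (f := fun Y : AmbientIndex d → ℝ => ((fun i => Y (spaceIdx i)), Y inftyIdx)) (hF _ hX.2)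
      contDiff_spaceProj.contDiffAt.contDiffWithinAt fun Y hY => hY.2

/-- Only `∂_t` changes the degree, lowering it by one and producing the old degree as a factor; the
other directions differentiate the coefficient. This turns every ambient derivative into an
operation on functions of `(x, ρ)`. -/
theorem pd_homogeneous (hU : IsOpen U) (hF : SmoothFamilyOn U F) (hX : X ∈ ambientDomain U)
    (I : AmbientIndex d) (n : ℤ) :
    pd I (homogeneous n F) X = homogeneous (n - weight I) (gradedPd I n F) X := by
  rw [pd_eq_deriv (differentiableAt_of_contDiffOn (isOpen_ambientDomain hU)
    (contDiffOn_homogeneous hF n) hX)]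
  rcases I with _ | μ | _
  · simp only [homogeneous, Function.update_self, ne_eq, reduceCtorEq, not_false_eq_true,
      Function.update_of_ne, weight, gradedPd]
    rw [deriv_mul_const (differentiableAt_zpow.2 (Or.inl hX.1.ne')), deriv_zpow]
    ring
  · have hFd : DifferentiableAt ℝ (fun y => F y (X inftyIdx)) (fun i => X (spaceIdx i)) := by
      have := differentiableAt_of_contDiffOn hU hF hX.2
      exact this.comp (fun i => X (spaceIdx i)) (f := fun y => (y, X inftyIdx)) (by fun_prop)
    simp only [homogeneous, ne_eq, reduceCtorEq, not_false_eq_true,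
      Function.update_of_ne, weight, gradedPd, sub_zero]
    rw [deriv_const_mul_field, pd_eq_deriv hFd]
    congr 2
    ext s
    congr 1
    ext i
    by_cases h : i = μ
    · subst h; simp
    · simp [h, Function.update_of_ne]
  · simp only [homogeneous, Function.update_self, ne_eq, reduceCtorEq, not_false_eq_true,
      Function.update_of_ne, weight, gradedPd, sub_zero]
    rw [deriv_const_mul_field]
    have h : ∀ s, (fun i => Function.update X inftyIdx s (spaceIdx i))
        = fun i => X (spaceIdx i) := fun s => funext fun i =>
      Function.update_of_ne (by simp) _ _
    simp only [h]

theorem SmoothFamilyOn.slice (hF : SmoothFamilyOn U F) (ρ : ℝ) :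
    ContDiffOn ℝ ∞ (fun y => F y ρ) {y | (y, ρ) ∈ U} :=
  ContDiffOn.comp (g := fun q : (Fin d → ℝ) × ℝ => F q.1 q.2) hF
    (f := fun y => (y, ρ)) (by fun_prop) (fun _ h => h)

theorem isOpen_slice (hU : IsOpen U) (ρ : ℝ) : IsOpen {y | (y, ρ) ∈ U} :=
  hU.preimage (by fun_prop : Continuous fun y : Fin d → ℝ => (y, ρ))

theorem isOpen_fiber (hU : IsOpen U) (x : Fin d → ℝ) : IsOpen {r | (x, r) ∈ U} :=
  hU.preimage (by fun_prop : Continuous fun r : ℝ => (x, r))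

theorem SmoothFamilyOn.differentiableAt_left (hU : IsOpen U) (hF : SmoothFamilyOn U F)
    {x : Fin d → ℝ} {ρ : ℝ} (hx : (x, ρ) ∈ U) : DifferentiableAt ℝ (fun y => F y ρ) x :=
  differentiableAt_of_contDiffOn (isOpen_slice hU ρ) (hF.slice ρ) hx

theorem SmoothFamilyOn.differentiableAt_right (hU : IsOpen U) (hF : SmoothFamilyOn U F)
    {x : Fin d → ℝ} {ρ : ℝ} (hx : (x, ρ) ∈ U) : DifferentiableAt ℝ (fun r => F x r) ρ :=
  DifferentiableAt.comp (g := fun q : (Fin d → ℝ) × ℝ => F q.1 q.2) ρ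
    (differentiableAt_of_contDiffOn hU hF hx) (f := fun r => (x, r)) (by fun_prop)

theorem smoothFamilyOn_gradedPd (hU : IsOpen U) (hF : SmoothFamilyOn U F) (I : AmbientIndex d)
    (n : ℤ) : SmoothFamilyOn U (gradedPd I n F) := by
  have hfd : ContDiffOn ℝ ∞ (fderiv ℝ fun q : (Fin d → ℝ) × ℝ => F q.1 q.2) U :=
    ContDiffOn.fderiv_of_isOpen hF hU (by simp)
  rcases I with _ | μ | _
  · exact contDiffOn_const.mul hF
  · refine ContDiffOn.congr (hfd.clm_apply (contDiffOn_const (c := (Pi.single μ 1, (0 : ℝ))))) ?_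
    intro q hq
    have hd := (differentiableAt_of_contDiffOn hU hF hq).hasFDerivAt
    have h1 : HasFDerivAt (fun y : Fin d → ℝ => (y, q.2))
      ((ContinuousLinearMap.id ℝ (Fin d → ℝ)).prod 0) q.1 :=
        (hasFDerivAt_id q.1).prodMk (hasFDerivAt_const q.2 q.1)
    have h2 := HasFDerivAt.comp (g := fun q : (Fin d → ℝ) × ℝ => F q.1 q.2) q.1 hd h1
    simp only [gradedPd, pd]
    rw [show (fun y => F y q.2) = (fun q : (Fin d → ℝ) × ℝ => F q.1 q.2) ∘ fun y => (y, q.2) from rfl,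
      h2.fderiv]
    simp
  · refine ContDiffOn.congr (hfd.clm_apply (contDiffOn_const (c := ((0 : Fin d → ℝ), (1 : ℝ))))) ?_
    intro q hq
    have hd := (differentiableAt_of_contDiffOn hU hF hq).hasFDerivAt
    have h1 : HasDerivAt (fun r : ℝ => (q.1, r)) ((0 : Fin d → ℝ), (1 : ℝ)) q.2 :=
      (hasDerivAt_const q.2 q.1).prodMk (hasDerivAt_id q.2)
    exact (HasFDerivAt.comp_hasDerivAt (l := fun q : (Fin d → ℝ) × ℝ => F q.1 q.2) q.2 hd h1).deriv

end Graded

/-! ### Homogeneity of the ambient metric, connection and Ricci tensor. -/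

section GradedTensors

variable {d : ℕ}

/-- On the open set `U`, `g` is a smooth family of nondegenerate symmetric matrices. -/
structure IsSmoothMetricFamilyOn (U : Set ((Fin d → ℝ) × ℝ))
    (g : (Fin d → ℝ) → ℝ → Matrix (Fin d) (Fin d) ℝ) : Prop where
  isOpen : IsOpen U
  symm : ∀ x ρ, (x, ρ) ∈ U → (g x ρ).transpose = g x ρ
  det_ne_zero : ∀ x ρ, (x, ρ) ∈ U → (g x ρ).det ≠ 0
  smooth : ∀ μ ν, SmoothFamilyOn U (fun x ρ => g x ρ μ ν)

/-- The components of the ambient metric on `t = 1`. -/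
def gradedMetric (g : (Fin d → ℝ) → ℝ → Matrix (Fin d) (Fin d) ℝ) (x : Fin d → ℝ) (ρ : ℝ) :
    Matrix (AmbientIndex d) (AmbientIndex d) ℝ
  | Sum.inl _, Sum.inl _ => 2 * ρ
  | Sum.inl _, Sum.inr (Sum.inl _) => 0
  | Sum.inl _, Sum.inr (Sum.inr _) => 1
  | Sum.inr (Sum.inl _), Sum.inl _ => 0
  | Sum.inr (Sum.inl μ), Sum.inr (Sum.inl ν) => g x ρ μ ν
  | Sum.inr (Sum.inl _), Sum.inr (Sum.inr _) => 0
  | Sum.inr (Sum.inr _), Sum.inl _ => 1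
  | Sum.inr (Sum.inr _), Sum.inr (Sum.inl _) => 0
  | Sum.inr (Sum.inr _), Sum.inr (Sum.inr _) => 0

/-- The components of the inverse ambient metric on `t = 1`. -/
def gradedInv (g : (Fin d → ℝ) → ℝ → Matrix (Fin d) (Fin d) ℝ) (x : Fin d → ℝ) (ρ : ℝ) :
    Matrix (AmbientIndex d) (AmbientIndex d) ℝ
  | Sum.inl _, Sum.inl _ => 0
  | Sum.inl _, Sum.inr (Sum.inl _) => 0
  | Sum.inl _, Sum.inr (Sum.inr _) => 1
  | Sum.inr (Sum.inl _), Sum.inl _ => 0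
  | Sum.inr (Sum.inl μ), Sum.inr (Sum.inl ν) => (g x ρ)⁻¹ μ ν
  | Sum.inr (Sum.inl _), Sum.inr (Sum.inr _) => 0
  | Sum.inr (Sum.inr _), Sum.inl _ => 1
  | Sum.inr (Sum.inr _), Sum.inr (Sum.inl _) => 0
  | Sum.inr (Sum.inr _), Sum.inr (Sum.inr _) => -(2 * ρ)

/-- The Christoffel symbols of the ambient metric on `t = 1`. -/
def gradedChristoffel (g : (Fin d → ℝ) → ℝ → Matrix (Fin d) (Fin d) ℝ) (K I J : AmbientIndex d)
    (x : Fin d → ℝ) (ρ : ℝ) : ℝ :=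
  (1 / 2 : ℝ) * ∑ L, gradedInv g x ρ K L *
    (gradedPd I (2 - weight L - weight J) (fun y r => gradedMetric g y r L J) x ρ
      + gradedPd J (2 - weight L - weight I) (fun y r => gradedMetric g y r L I) x ρ
      - gradedPd L (2 - weight I - weight J) (fun y r => gradedMetric g y r I J) x ρ)

/-- The Ricci tensor of the ambient metric on `t = 1`. -/
def gradedRicci (g : (Fin d → ℝ) → ℝ → Matrix (Fin d) (Fin d) ℝ) (I J : AmbientIndex d)
    (x : Fin d → ℝ) (ρ : ℝ) : ℝ :=
  (∑ K, gradedPd K (weight K - weight I - weight J) (gradedChristoffel g K I J) x ρ)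
    - (∑ K, gradedPd J (weight K - weight I - weight K) (gradedChristoffel g K I K) x ρ)
    + (∑ K, ∑ L, gradedChristoffel g K K L x ρ * gradedChristoffel g L I J x ρ)
    - ∑ K, ∑ L, gradedChristoffel g K J L x ρ * gradedChristoffel g L I K x ρ

variable {g : (Fin d → ℝ) → ℝ → Matrix (Fin d) (Fin d) ℝ} {U : Set ((Fin d → ℝ) × ℝ)}

theorem ambientMetric_eq_homogeneous {X : AmbientIndex d → ℝ} (I J : AmbientIndex d) :
    ambientMetric g X I J
      = homogeneous (2 - weight I - weight J) (fun y r => gradedMetric g y r I J) X := by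
  rcases I with _ | μ | _ <;> rcases J with _ | ν | _ <;>
    simp [ambientMetric, homogeneous, gradedMetric, weight]

namespace IsSmoothMetricFamilyOn

variable (hg : IsSmoothMetricFamilyOn U g)
include hg

theorem slice (ρ : ℝ) : IsSmoothMetricOn {y | (y, ρ) ∈ U} (fun y => g y ρ) where
  isOpen := isOpen_slice hg.isOpen ρ
  symm y hy := hg.symm y ρ hy
  det_ne_zero y hy := hg.det_ne_zero y ρ hy
  smooth μ ν := (hg.smooth μ ν).slice ρ

theorem smooth_gradedMetric (I J : AmbientIndex d) :
    SmoothFamilyOn U (fun y r => gradedMetric g y r I J) := by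
  rcases I with _ | μ | _ <;> rcases J with _ | ν | _
  case inr.inl.inr.inl => exact hg.smooth μ ν
  all_goals
    simp only [SmoothFamilyOn, gradedMetric]
    fun_prop

/-- The metric splits into the block of `g` and the `(t, ρ)` block with rows `(2ρ, 1)`, `(1, 0)`,
whose inverse has rows `(0, 1)`, `(1, -2ρ)`. -/
theorem gradedMetric_mul_gradedInv {x : Fin d → ℝ} {ρ : ℝ} (hx : (x, ρ) ∈ U) :
    gradedMetric g x ρ * gradedInv g x ρ = 1 := by
  have h : ∀ μ ν, ∑ ξ, g x ρ μ ξ * (g x ρ)⁻¹ ξ ν = (1 : Matrix (Fin d) (Fin d) ℝ) μ ν := by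
    intro μ ν
    rw [← (hg.slice ρ).mul_inv hx, Matrix.mul_apply]
  ext I J
  rw [Matrix.mul_apply, sum_ambientIndex]
  rcases I with _ | μ | _ <;> rcases J with _ | ν | _ <;>
    simp [gradedMetric, gradedInv, h, Matrix.one_apply]

/-- The powers of `t` attached to the summed index cancel, so the product is the one at `t = 1`
times `t ^ (weight J - weight I)`, a factor that is `1` on the diagonal. -/
theorem ambient_mul (X : AmbientIndex d → ℝ) (hX : X ∈ ambientDomain U) : ambientMetric g X *
      Matrix.of (fun I J => homogeneous (weight I + weight J - 2) (fun y r => gradedInv g y r I J) X)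
    = 1 := by
  have ht : X zeroIdx ≠ 0 := hX.1.ne'
  ext I J
  have h := congrFun (congrFun (hg.gradedMetric_mul_gradedInv hX.2) I) J
  rw [Matrix.mul_apply] at h ⊢
  have h2 : ∀ L, ambientMetric g X I L * homogeneous (weight L + weight J - 2)
        (fun y r => gradedInv g y r L J) X
      = X zeroIdx ^ (weight J - weight I) *
        (gradedMetric g (fun i => X (spaceIdx i)) (X inftyIdx) I L
          * gradedInv g (fun i => X (spaceIdx i)) (X inftyIdx) L J) := by
    intro L
    rw [ambientMetric_eq_homogeneous, homogeneous, homogeneous,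
      show weight J - weight I = (2 - weight I - weight L) + (weight L + weight J - 2) by ring,
      zpow_add₀ ht]
    ring
  simp only [Matrix.of_apply, h2]
  rw [← Finset.mul_sum, h, Matrix.one_apply]
  split_ifs with hIJ
  · simp [hIJ]
  · simp

theorem inv_ambientMetric {X : AmbientIndex d → ℝ} (hX : X ∈ ambientDomain U)
    (I J : AmbientIndex d) : (ambientMetric g X)⁻¹ I J
      = homogeneous (weight I + weight J - 2) (fun y r => gradedInv g y r I J) X := by
  rw [Matrix.inv_eq_right_inv (hg.ambient_mul X hX), Matrix.of_apply]

theorem ambient : IsSmoothMetricOn (ambientDomain U) (ambientMetric g) where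
  isOpen := isOpen_ambientDomain hg.isOpen
  symm X hX := by
    ext I J
    rcases I with _ | μ | _ <;> rcases J with _ | ν | _ <;>
      simp [ambientMetric, Matrix.transpose_apply]
    exact Or.inl ((hg.slice _).apply_comm hX.2 _ _)
  det_ne_zero X hX h0 := by
    have h := congrArg Matrix.det (hg.ambient_mul X hX)
    rw [Matrix.det_mul, h0, zero_mul, Matrix.det_one] at h
    exact zero_ne_one h
  smooth I J := by
    simp only [ambientMetric_eq_homogeneous]
    exact contDiffOn_homogeneous (hg.smooth_gradedMetric I J) _

/-- Smoothness is pulled back from the inverse ambient metric along the embedding of the slice `t =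
1`. -/
theorem smooth_gradedInv (I J : AmbientIndex d) :
    SmoothFamilyOn U (fun y r => gradedInv g y r I J) := by
  have h := hg.ambient.smooth_inv I J
  have h1 : ContDiff ℝ ∞ (fun q : (Fin d → ℝ) × ℝ => ambientPoint 1 q.1 q.2) := by
    rw [contDiff_pi]
    rintro (_ | μ | _) <;> simp only [ambientPoint] <;> fun_prop
  have h2 := h.comp (s := U) h1.contDiffOn fun q hq => ⟨by simp [ambientPoint], hq⟩
  refine ContDiffOn.congr h2 fun q hq => ?_
  have h3 : ambientPoint 1 q.1 q.2 ∈ ambientDomain U := ⟨by simp [ambientPoint], hq⟩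
  change gradedInv g q.1 q.2 I J = (ambientMetric g (ambientPoint 1 q.1 q.2))⁻¹ I J
  rw [hg.inv_ambientMetric h3]
  simp [homogeneous, ambientPoint]

theorem smooth_gradedChristoffel (K I J : AmbientIndex d) :
    SmoothFamilyOn U (gradedChristoffel g K I J) := by
  have h := fun I J L n => smoothFamilyOn_gradedPd hg.isOpen (hg.smooth_gradedMetric I J) L n
  exact contDiffOn_const.mul (ContDiffOn.sum fun L _ => ContDiffOn.mul (hg.smooth_gradedInv K L)
    (((h L J I _).add (h L I J _)).sub (h I J L _)))

theorem smooth_gradedRicci (I J : AmbientIndex d) : SmoothFamilyOn U (gradedRicci g I J) := by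
  have h := fun K I J L n =>
    smoothFamilyOn_gradedPd hg.isOpen (hg.smooth_gradedChristoffel K I J) L n
  refine ContDiffOn.sub (ContDiffOn.add (ContDiffOn.sub ?_ ?_) ?_) ?_
  · exact ContDiffOn.sum fun K _ => h _ _ _ _ _
  · exact ContDiffOn.sum fun K _ => h _ _ _ _ _
  · exact ContDiffOn.sum fun K _ => ContDiffOn.sum fun L _ =>
      ContDiffOn.mul (hg.smooth_gradedChristoffel _ _ _) (hg.smooth_gradedChristoffel _ _ _)
  · exact ContDiffOn.sum fun K _ => ContDiffOn.sum fun L _ =>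
      ContDiffOn.mul (hg.smooth_gradedChristoffel _ _ _) (hg.smooth_gradedChristoffel _ _ _)

variable {X : AmbientIndex d → ℝ} (hX : X ∈ ambientDomain U)
include hX

/-- An upper index `0` contributes `+1` to the degree and a lower one `-1`; the contributions of the
summed index, and the `2` and `-2` of the metric and its inverse, cancel. -/
theorem christoffel_ambientMetric (K I J : AmbientIndex d) :
    christoffel (ambientMetric g) K I J X
      = homogeneous (weight K - weight I - weight J) (gradedChristoffel g K I J) X := by
  have ht : X zeroIdx ≠ 0 := hX.1.ne'
  have h : ∀ L I J, pd L (fun Y => ambientMetric g Y I J) X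
      = homogeneous (2 - weight I - weight J - weight L)
        (gradedPd L (2 - weight I - weight J) fun y r => gradedMetric g y r I J) X := by
    intro L I J
    rw [← pd_homogeneous hg.isOpen (hg.smooth_gradedMetric I J) hX]
    exact congrArg (fun f => pd L f X) (funext fun _ => ambientMetric_eq_homogeneous I J)
  simp only [christoffel, h, hg.inv_ambientMetric hX]
  simp only [homogeneous, gradedChristoffel]
  rw [mul_left_comm]
  congr 1
  rw [Finset.mul_sum]
  refine Finset.sum_congr rfl fun L _ => ?_
  rw [show (2 - weight L - weight J - weight I : ℤ)
      = (weight K - weight I - weight J) - (weight K + weight L - 2) by ring,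
    show (2 - weight L - weight I - weight J : ℤ)
      = (weight K - weight I - weight J) - (weight K + weight L - 2) by ring,
    show (2 - weight I - weight J - weight L : ℤ)
      = (weight K - weight I - weight J) - (weight K + weight L - 2) by ring,
    zpow_sub₀ ht (weight K - weight I - weight J)]
  have := zpow_ne_zero (weight K + weight L - 2) ht
  field_simp

theorem pd_christoffel_ambientMetric (L K I J : AmbientIndex d) :
    pd L (christoffel (ambientMetric g) K I J) X
      = homogeneous (weight K - weight I - weight J - weight L)
          (gradedPd L (weight K - weight I - weight J) (gradedChristoffel g K I J)) X := by
  rw [pd_congr (isOpen_ambientDomain hg.isOpen) hX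
    (fun Y hY => hg.christoffel_ambientMetric hY K I J) L,
    pd_homogeneous hg.isOpen (hg.smooth_gradedChristoffel K I J) hX]

theorem ricci_ambientMetric (I J : AmbientIndex d) : ricci (ambientMetric g) I J X
    = homogeneous (-weight I - weight J) (gradedRicci g I J) X := by
  have ht : X zeroIdx ≠ 0 := hX.1.ne'
  simp only [ricci, hg.pd_christoffel_ambientMetric hX, hg.christoffel_ambientMetric hX]
  simp only [homogeneous, gradedRicci, mul_add, mul_sub, Finset.mul_sum]
  have h : ∀ a b c : ℤ, ∀ u v : ℝ, a + b = c →
      X zeroIdx ^ a * u * (X zeroIdx ^ b * v) = X zeroIdx ^ c * (u * v) := by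
    intro a b c u v h
    rw [← h, zpow_add₀ ht]
    ring
  congr 1
  · congr 1
    · congr 1
      · exact Finset.sum_congr rfl fun K _ => by congr 2; ring
      · exact Finset.sum_congr rfl fun K _ => by congr 2; ring
    · exact Finset.sum_congr rfl fun K _ => Finset.sum_congr rfl fun L _ => by
        exact h _ _ _ _ _ (by ring)
  · exact Finset.sum_congr rfl fun K _ => Finset.sum_congr rfl fun L _ => by
      exact h _ _ _ _ _ (by ring)

end IsSmoothMetricFamilyOn

end GradedTensors

/-! ### Explicit ambient Christoffel symbols and vanishing of the `0`-components. -/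

section Table

variable {d : ℕ}

/-- `½ g^{λξ} g'_{ξμ}`. -/
def shape (g : (Fin d → ℝ) → ℝ → Matrix (Fin d) (Fin d) ℝ) (x : Fin d → ℝ) (ρ : ℝ)
    (l μ : Fin d) : ℝ :=
  1 / 2 * ∑ ξ, (g x ρ)⁻¹ l ξ * gPrime g x ρ ξ μ

/-- The explicit Christoffel symbols of the ambient metric on `t = 1`. -/
def christoffelTable (g : (Fin d → ℝ) → ℝ → Matrix (Fin d) (Fin d) ℝ) (x : Fin d → ℝ) (ρ : ℝ) :
    AmbientIndex d → AmbientIndex d → AmbientIndex d → ℝ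
  | Sum.inl _, Sum.inl _, _ => 0
  | Sum.inl _, Sum.inr (Sum.inl _), Sum.inl _ => 0
  | Sum.inl _, Sum.inr (Sum.inl μ), Sum.inr (Sum.inl ν) => -(1 / 2 * gPrime g x ρ μ ν)
  | Sum.inl _, Sum.inr (Sum.inl _), Sum.inr (Sum.inr _) => 0
  | Sum.inl _, Sum.inr (Sum.inr _), _ => 0
  | Sum.inr (Sum.inl _), Sum.inl _, Sum.inl _ => 0
  | Sum.inr (Sum.inl l), Sum.inl _, Sum.inr (Sum.inl ν) => if l = ν then 1 else 0
  | Sum.inr (Sum.inl _), Sum.inl _, Sum.inr (Sum.inr _) => 0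
  | Sum.inr (Sum.inl l), Sum.inr (Sum.inl μ), Sum.inl _ => if l = μ then 1 else 0
  | Sum.inr (Sum.inl l), Sum.inr (Sum.inl μ), Sum.inr (Sum.inl ν) =>
      christoffel (fun y => g y ρ) l μ ν x
  | Sum.inr (Sum.inl l), Sum.inr (Sum.inl μ), Sum.inr (Sum.inr _) => shape g x ρ l μ
  | Sum.inr (Sum.inl _), Sum.inr (Sum.inr _), Sum.inl _ => 0
  | Sum.inr (Sum.inl l), Sum.inr (Sum.inr _), Sum.inr (Sum.inl μ) => shape g x ρ l μ
  | Sum.inr (Sum.inl _), Sum.inr (Sum.inr _), Sum.inr (Sum.inr _) => 0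
  | Sum.inr (Sum.inr _), Sum.inl _, Sum.inl _ => 0
  | Sum.inr (Sum.inr _), Sum.inl _, Sum.inr (Sum.inl _) => 0
  | Sum.inr (Sum.inr _), Sum.inl _, Sum.inr (Sum.inr _) => 1
  | Sum.inr (Sum.inr _), Sum.inr (Sum.inl _), Sum.inl _ => 0
  | Sum.inr (Sum.inr _), Sum.inr (Sum.inl μ), Sum.inr (Sum.inl ν) =>
      -g x ρ μ ν + ρ * gPrime g x ρ μ ν
  | Sum.inr (Sum.inr _), Sum.inr (Sum.inl _), Sum.inr (Sum.inr _) => 0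
  | Sum.inr (Sum.inr _), Sum.inr (Sum.inr _), Sum.inl _ => 1
  | Sum.inr (Sum.inr _), Sum.inr (Sum.inr _), Sum.inr _ => 0

variable {g : (Fin d → ℝ) → ℝ → Matrix (Fin d) (Fin d) ℝ} {U : Set ((Fin d → ℝ) × ℝ)}
  {x : Fin d → ℝ} {ρ : ℝ}

theorem gradedPd_congr (hU : IsOpen U) {F F' : (Fin d → ℝ) → ℝ → ℝ} (hx : (x, ρ) ∈ U)
    (h : ∀ y r, (y, r) ∈ U → F y r = F' y r) (I : AmbientIndex d) (n : ℤ) :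
    gradedPd I n F x ρ = gradedPd I n F' x ρ := by
  rcases I with _ | μ | _
  · simp only [gradedPd, h x ρ hx]
  · exact pd_congr (isOpen_slice hU ρ) hx (fun y hy => h y ρ hy) μ
  · exact Filter.EventuallyEq.deriv_eq
      (Filter.eventually_of_mem ((isOpen_fiber hU x).mem_nhds hx) fun r hr => h x r hr)

theorem ambientPoint_mem {t : ℝ} (ht : 0 < t) (hx : (x, ρ) ∈ U) :
    ambientPoint t x ρ ∈ ambientDomain U := ⟨ht, hx⟩

namespace IsSmoothMetricFamilyOn

variable (hg : IsSmoothMetricFamilyOn U g)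
include hg

theorem gPrime_comm (hx : (x, ρ) ∈ U) (μ ν : Fin d) : gPrime g x ρ μ ν = gPrime g x ρ ν μ :=
  gradedPd_congr hg.isOpen (F := fun y r => g y r μ ν) (F' := fun y r => g y r ν μ) hx
    (fun _ r hy => (hg.slice r).apply_comm hy μ ν) inftyIdx 0

theorem gradedChristoffel_eq (hx : (x, ρ) ∈ U) (K I J : AmbientIndex d) :
    gradedChristoffel g K I J x ρ = christoffelTable g x ρ K I J := by
  have hinv : ∀ l ν, ∑ ξ, (g x ρ)⁻¹ l ξ * g x ρ ξ ν = if l = ν then 1 else 0 := by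
    intro l ν
    rw [← Matrix.mul_apply, (hg.slice ρ).inv_mul hx, Matrix.one_apply]
  have hgP : ∀ μ ν, deriv (fun r => g x r μ ν) ρ = gPrime g x ρ μ ν := fun _ _ => rfl
  -- The factor `2` is the degree of `t² g_{μν}`, produced by `∂_t`; this sum yields the entries
  -- `Γ^l_{0ν} = δ^l_ν`.
  have h2 : ∀ l ν, ∑ ξ, (g x ρ)⁻¹ l ξ * (2 * g x ρ ξ ν) = 2 * if l = ν then 1 else 0 := by
    intro l ν
    rw [← hinv, Finset.mul_sum]
    exact Finset.sum_congr rfl fun _ _ => by ring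
  have hd2 : deriv (fun r : ℝ => 2 * r) ρ = 2 := by
    rw [deriv_const_mul_field, deriv_id'', mul_one]
  unfold gradedChristoffel
  rw [sum_ambientIndex]
  rcases K with _ | l | _ <;> rcases I with _ | μ | _ <;> rcases J with _ | ν | _ <;>
    simp [gradedInv, gradedMetric, gradedPd, weight, christoffelTable, shape, christoffel, hgP, h2, hd2]
  all_goals first | (norm_num; done) | ring

theorem gradedPd_gradedChristoffel (hx : (x, ρ) ∈ U) (L K I J : AmbientIndex d) (n : ℤ) :
    gradedPd L n (gradedChristoffel g K I J) x ρ
      = gradedPd L n (fun y r => christoffelTable g y r K I J) x ρ :=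
  gradedPd_congr hg.isOpen hx (fun _ _ h => hg.gradedChristoffel_eq h K I J) L n

/-- The table gives `∇T = id` for `T = t ∂_t`, so the curvature kills `T`. In coordinates, for `J =
ν`, only two traces of the Christoffel symbols of `g` survive, equal by symmetry of the lower
indices. -/
theorem gradedRicci_zero_left (hx : (x, ρ) ∈ U) (J : AmbientIndex d) :
    gradedRicci g zeroIdx J x ρ = 0 := by
  simp only [gradedRicci, hg.gradedPd_gradedChristoffel hx, hg.gradedChristoffel_eq hx,
    sum_ambientIndex]
  rcases J with _ | ν | _ <;>
    simp [christoffelTable, gradedPd, weight]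
  · ring
  · rw [sub_eq_zero]
    exact Finset.sum_congr rfl fun l _ => (hg.slice ρ).christoffel_comm hx l l ν

theorem ambientRicci_eq {t : ℝ} (ht : 0 < t) (hx : (x, ρ) ∈ U) (I J : AmbientIndex d) :
    ambientRicci g I J t x ρ = t ^ (-weight I - weight J) * gradedRicci g I J x ρ :=
  hg.ricci_ambientMetric (ambientPoint_mem ht hx) I J

theorem slicedRicci_eq (hx : (x, ρ) ∈ U) (I J : AmbientIndex d) :
    slicedRicci g I J x ρ = gradedRicci g I J x ρ := by
  rw [slicedRicci, hg.ambientRicci_eq one_pos hx, one_zpow, one_mul]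

theorem slicedRicci_comm (hx : (x, ρ) ∈ U) (I J : AmbientIndex d) :
    slicedRicci g I J x ρ = slicedRicci g J I x ρ :=
  hg.ambient.ricci_comm (ambientPoint_mem one_pos hx) I J

theorem slicedRicci_zero_left (hx : (x, ρ) ∈ U) (J : AmbientIndex d) :
    slicedRicci g zeroIdx J x ρ = 0 := by
  rw [hg.slicedRicci_eq hx, hg.gradedRicci_zero_left hx]

theorem slicedRicci_zero_right (hx : (x, ρ) ∈ U) (I : AmbientIndex d) :
    slicedRicci g I zeroIdx x ρ = 0 := by
  rw [hg.slicedRicci_comm hx, hg.slicedRicci_zero_left hx]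

/-- A nonzero power of `t` occurs only when an index is `0`, and then the component vanishes. -/
theorem ambientRicci_eq_slicedRicci {t : ℝ} (ht : 0 < t) (hx : (x, ρ) ∈ U)
    (I J : AmbientIndex d) : ambientRicci g I J t x ρ = slicedRicci g I J x ρ := by
  rw [hg.ambientRicci_eq ht hx, ← hg.slicedRicci_eq hx]
  rcases I with _ | I
  · rw [hg.slicedRicci_zero_left hx, mul_zero]
  · rcases J with _ | J
    · rw [hg.slicedRicci_zero_right hx, mul_zero]
    · simp [weight]

theorem smooth_slicedRicci (I J : AmbientIndex d) : SmoothFamilyOn U (slicedRicci g I J) :=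
  ContDiffOn.congr (hg.smooth_gradedRicci I J) fun _ hq => hg.slicedRicci_eq hq I J

end IsSmoothMetricFamilyOn

end Table

/-! ### The two identities as components of the ambient Bianchi identity. -/

section Identities

variable {d : ℕ}

/-- The mixed Ricci tensor of the ambient metric on `t = 1`. -/
def gradedMixedRicci (g : (Fin d → ℝ) → ℝ → Matrix (Fin d) (Fin d) ℝ) (K J : AmbientIndex d)
    (x : Fin d → ℝ) (ρ : ℝ) : ℝ :=
  ∑ A, gradedInv g x ρ K A * slicedRicci g A J x ρ

/-- The explicit mixed Ricci tensor of the ambient metric on `t = 1`. -/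
def mixedTable (g : (Fin d → ℝ) → ℝ → Matrix (Fin d) (Fin d) ℝ) (x : Fin d → ℝ) (ρ : ℝ) :
    AmbientIndex d → AmbientIndex d → ℝ
  | Sum.inl _, Sum.inl _ => 0
  | Sum.inl _, Sum.inr (Sum.inl ν) => SInf g x ρ ν
  | Sum.inl _, Sum.inr (Sum.inr _) => SInfInf g x ρ
  | Sum.inr (Sum.inl _), Sum.inl _ => 0
  | Sum.inr (Sum.inl μ), Sum.inr (Sum.inl ν) => ∑ ξ, (g x ρ)⁻¹ μ ξ * S g x ρ ξ ν
  | Sum.inr (Sum.inl μ), Sum.inr (Sum.inr _) => ∑ ξ, (g x ρ)⁻¹ μ ξ * SInf g x ρ ξ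
  | Sum.inr (Sum.inr _), Sum.inl _ => 0
  | Sum.inr (Sum.inr _), Sum.inr (Sum.inl ν) => -(2 * (ρ * SInf g x ρ ν))
  | Sum.inr (Sum.inr _), Sum.inr (Sum.inr _) => -(2 * (ρ * SInfInf g x ρ))

variable {g : (Fin d → ℝ) → ℝ → Matrix (Fin d) (Fin d) ℝ} {U : Set ((Fin d → ℝ) × ℝ)}
  {x : Fin d → ℝ} {ρ : ℝ}

namespace IsSmoothMetricFamilyOn

variable (hg : IsSmoothMetricFamilyOn U g)
include hg

/-- As the `0`-components vanish, raising an index involves only `g^{0∞} = 1`, `g^{∞∞} = -2ρ` and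
`g^{μν}`. In particular the upper index `0` carries the components with lower index `∞`. -/
theorem gradedMixedRicci_eq (hx : (x, ρ) ∈ U) (K J : AmbientIndex d) :
    gradedMixedRicci g K J x ρ = mixedTable g x ρ K J := by
  have h0 := hg.slicedRicci_zero_left hx
  have h0' := hg.slicedRicci_zero_right hx
  rw [gradedMixedRicci, sum_ambientIndex]
  rcases K with _ | μ | _ <;> rcases J with _ | ν | _ <;>
    simp [gradedInv, mixedTable, h0, h0', S, SInf, SInfInf, mul_assoc]
  · exact hg.slicedRicci_comm hx _ _
  · rw [hg.slicedRicci_comm hx]; simp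

theorem smooth_gradedMixedRicci (K J : AmbientIndex d) :
    SmoothFamilyOn U (gradedMixedRicci g K J) :=
  ContDiffOn.sum fun A _ => ContDiffOn.mul (hg.smooth_gradedInv K A) (hg.smooth_slicedRicci A J)

theorem mixedRicci_ambientMetric {X : AmbientIndex d → ℝ} (hX : X ∈ ambientDomain U)
    (K J : AmbientIndex d) : mixedRicci (ambientMetric g) X K J
      = homogeneous (weight K - weight J - 2) (gradedMixedRicci g K J) X := by
  have ht : X zeroIdx ≠ 0 := hX.1.ne'
  simp only [mixedRicci, hg.inv_ambientMetric hX, hg.ricci_ambientMetric hX, homogeneous,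
    gradedMixedRicci, Finset.mul_sum]
  refine Finset.sum_congr rfl fun A _ => ?_
  rw [hg.slicedRicci_eq hX.2, show weight K - weight J - 2
    = (weight K + weight A - 2) + (-weight A - weight J) by ring, zpow_add₀ ht]
  ring

/-- The mixed Ricci components have degree `weight K - weight J - 2`, so evaluating the ambient
identity at `t = 1` eliminates `t` altogether. -/
theorem graded_bianchi (hx : (x, ρ) ∈ U) (J : AmbientIndex d) :
    ∑ K, gradedPd K (weight K - weight J - 2) (fun y r => mixedTable g y r K J) x ρ
      + ∑ K, ∑ A, christoffelTable g x ρ K K A * mixedTable g x ρ A J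
      - ∑ I, ∑ A, christoffelTable g x ρ I J A * mixedTable g x ρ A I
      = 1 / 2 * ∑ K, gradedPd J (weight K - weight K - 2) (fun y r => mixedTable g y r K K) x ρ := by
  have hX : ambientPoint 1 x ρ ∈ ambientDomain U := ambientPoint_mem one_pos hx
  have hpd : ∀ L K J, pd L (fun Y => mixedRicci (ambientMetric g) Y K J) (ambientPoint 1 x ρ)
      = gradedPd L (weight K - weight J - 2) (fun y r => mixedTable g y r K J) x ρ := by
    intro L K J
    rw [pd_congr (isOpen_ambientDomain hg.isOpen) hX
      (fun Y hY => hg.mixedRicci_ambientMetric hY K J) L,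
      pd_homogeneous hg.isOpen (hg.smooth_gradedMixedRicci K J) hX, homogeneous]
    refine Eq.trans ?_ (gradedPd_congr hg.isOpen hx (fun y r h => hg.gradedMixedRicci_eq h K J) L _)
    simp [ambientPoint]
  have hΓ : ∀ K I J, christoffel (ambientMetric g) K I J (ambientPoint 1 x ρ)
      = christoffelTable g x ρ K I J := by
    intro K I J
    rw [hg.christoffel_ambientMetric hX, ← hg.gradedChristoffel_eq hx]
    simp [homogeneous, ambientPoint]
  have hQ : ∀ K J, mixedRicci (ambientMetric g) (ambientPoint 1 x ρ) K J
      = mixedTable g x ρ K J := by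
    intro K J
    rw [hg.mixedRicci_ambientMetric hX, ← hg.gradedMixedRicci_eq hx]
    simp [homogeneous, ambientPoint]
  have h := hg.ambient.contracted_bianchi hX J
  simpa only [hpd, hΓ, hQ] using h

theorem smooth_S (μ ν : Fin d) : SmoothFamilyOn U (fun y r => S g y r μ ν) :=
  hg.smooth_slicedRicci _ _

theorem smooth_SInf (μ : Fin d) : SmoothFamilyOn U (fun y r => SInf g y r μ) :=
  hg.smooth_slicedRicci _ _

theorem smooth_SInfInf : SmoothFamilyOn U (SInfInf g) :=
  hg.smooth_slicedRicci _ _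

theorem smooth_inv (μ ν : Fin d) : SmoothFamilyOn U (fun y r => (g y r)⁻¹ μ ν) :=
  hg.smooth_gradedInv (spaceIdx μ) (spaceIdx ν)

theorem smooth_raised_S (μ ν : Fin d) :
    SmoothFamilyOn U (fun y r => ∑ ξ, (g y r)⁻¹ μ ξ * S g y r ξ ν) :=
  ContDiffOn.sum fun ξ _ => ContDiffOn.mul (hg.smooth_inv μ ξ) (hg.smooth_S ξ ν)

theorem smooth_STrace : SmoothFamilyOn U (STrace g) :=
  ContDiffOn.sum fun _ _ => ContDiffOn.sum fun _ _ =>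
    ContDiffOn.mul (hg.smooth_inv _ _) (hg.smooth_S _ _)

theorem STrace_eq (hx : (x, ρ) ∈ U) :
    STrace g x ρ = ∑ μ, ∑ ξ, (g x ρ)⁻¹ μ ξ * S g x ρ ξ μ :=
  Finset.sum_congr rfl fun _ _ => Finset.sum_congr rfl fun _ _ =>
    congrArg _ (hg.slicedRicci_comm hx _ _)

theorem sum_gradedPd_raised_S (hx : (x, ρ) ∈ U) (I : AmbientIndex d) (n : ℤ) :
    ∑ μ, gradedPd I n (fun y r => ∑ ξ, (g y r)⁻¹ μ ξ * S g y r ξ μ) x ρ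
      = gradedPd I n (STrace g) x ρ := by
  rw [gradedPd_congr hg.isOpen hx (fun y r h => hg.STrace_eq h)]
  rcases I with _ | ν | _
  · simp only [gradedPd, Finset.mul_sum]
  · exact (pd_sum _ (fun _ _ => (hg.smooth_raised_S _ _).differentiableAt_left hg.isOpen hx) ν).symm
  · exact (deriv_fun_sum
      (fun _ _ => (hg.smooth_raised_S _ _).differentiableAt_right hg.isOpen hx)).symm

theorem trace_shape (hx : (x, ρ) ∈ U) : ∑ l, shape g x ρ l l = 1 / 2 * trGPrime g x ρ := by
  simp only [shape, trGPrime, ← Finset.mul_sum]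
  congr 1
  exact Finset.sum_congr rfl fun l _ => Finset.sum_congr rfl fun ξ _ => by
    rw [hg.gPrime_comm hx ξ l]

theorem sum_neg_shape_mul (hx : (x, ρ) ∈ U) (c : ℝ) :
    ∑ l, -(shape g x ρ l l * c) = -(1 / 2 * trGPrime g x ρ * c) := by
  rw [Finset.sum_neg_distrib, ← Finset.sum_mul, hg.trace_shape hx]

/-- Both sides are the trace of `g⁻¹ g' g⁻¹ S`, by cyclicity and the symmetry of `S`. -/
theorem sum_gPrime_mul_SUp (hx : (x, ρ) ∈ U) : ∑ μ, ∑ ν, gPrime g x ρ μ ν * SUp g x ρ μ ν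
    = 2 * ∑ l, ∑ μ, shape g x ρ l μ * ∑ ξ, (g x ρ)⁻¹ μ ξ * S g x ρ ξ l := by
  let P : Matrix (Fin d) (Fin d) ℝ := Matrix.of (gPrime g x ρ)
  have h1 : ∑ μ, ∑ ν, gPrime g x ρ μ ν * SUp g x ρ μ ν
      = (P * ((g x ρ)⁻¹ * (S g x ρ).transpose * (g x ρ)⁻¹)).trace := by
    simp only [Matrix.trace, Matrix.diag, Matrix.mul_apply, P, Matrix.of_apply, SUp,
      Matrix.transpose_apply, Finset.sum_mul]
    refine Finset.sum_congr rfl fun μ _ => Finset.sum_congr rfl fun ν _ => congrArg _ ?_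
    refine Finset.sum_congr rfl fun ξ _ => Finset.sum_congr rfl fun χ _ => ?_
    rw [(hg.slice ρ).inv_apply_comm hx ξ μ]
    ring
  have h2 : 2 * ∑ l, ∑ μ, shape g x ρ l μ * ∑ ξ, (g x ρ)⁻¹ μ ξ * S g x ρ ξ l
      = ((g x ρ)⁻¹ * P * ((g x ρ)⁻¹ * S g x ρ)).trace := by
    simp only [Matrix.trace, Matrix.diag, Matrix.mul_apply (M := (g x ρ)⁻¹ * P), P, shape,
      Finset.mul_sum (a := (2 : ℝ))]
    refine Finset.sum_congr rfl fun l _ => Finset.sum_congr rfl fun μ _ => ?_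
    simp only [Matrix.mul_apply, Matrix.of_apply]
    ring
  have hS : (S g x ρ).transpose = S g x ρ := by
    ext μ ν
    exact hg.slicedRicci_comm hx _ _
  rw [h1, h2, hS, ← Matrix.mul_assoc, Matrix.trace_mul_comm]
  simp only [Matrix.mul_assoc]

/-- These are the terms `Γ^∞_{νa} S^a_∞ + Γ^a_{ν∞} S^∞_a` of the `ν`-component. Their `g'` parts
cancel, because `g^{∞∞} = -2ρ` matches the `ρ g'` in `Γ^∞_{νa}`. -/
theorem sum_metric_mul_raised (hx : (x, ρ) ∈ U) (s : Fin d → ℝ) (ν : Fin d) :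
    ∑ a, (-g x ρ ν a + ρ * gPrime g x ρ ν a) * ∑ ξ, (g x ρ)⁻¹ a ξ * s ξ
      + ∑ a, -(shape g x ρ a ν * (2 * (ρ * s a))) = -s ν := by
  have h1 : ∑ a, g x ρ ν a * ∑ ξ, (g x ρ)⁻¹ a ξ * s ξ = s ν := by
    have h := congrFun (Matrix.mulVec_mulVec s (g x ρ) (g x ρ)⁻¹) ν
    rw [(hg.slice ρ).mul_inv hx, Matrix.one_mulVec] at h
    exact h
  have h2 : ∑ a, gPrime g x ρ ν a * ∑ ξ, (g x ρ)⁻¹ a ξ * s ξ = 2 * ∑ a, shape g x ρ a ν * s a := by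
    simp only [Finset.mul_sum, shape, Finset.sum_mul]
    rw [Finset.sum_comm]
    refine Finset.sum_congr rfl fun a _ => Finset.sum_congr rfl fun ξ _ => ?_
    rw [hg.gPrime_comm hx ν ξ, (hg.slice ρ).inv_apply_comm hx ξ a]
    ring
  have h3 : ∑ a, -(shape g x ρ a ν * (2 * (ρ * s a))) = -(2 * ρ) * ∑ a, shape g x ρ a ν * s a := by
    rw [Finset.mul_sum]
    exact Finset.sum_congr rfl fun a _ => by ring
  simp only [add_mul, neg_mul, mul_assoc, Finset.sum_add_distrib, Finset.sum_neg_distrib, h1,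
    ← Finset.mul_sum, h2]
  rw [← Finset.sum_neg_distrib, h3]
  ring

/-- Raising an index turns the trace part into `½ S` times the identity, which is parallel; its
connection terms cancel and only `½ ∂_ν S` remains. -/
theorem div₂_sub_trace (hx : (x, ρ) ∈ U) (ν : Fin d) :
    div₂ (fun y => g y ρ) (fun y => S g y ρ - (1 / 2 * STrace g y ρ) • g y ρ) ν x
      = ∑ m, pd m (fun y => ∑ b, (g y ρ)⁻¹ m b * S g y ρ b ν) x
        + ∑ m, ∑ a, christoffel (fun y => g y ρ) m m a x * (∑ b, (g x ρ)⁻¹ a b * S g x ρ b ν)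
        - ∑ i, ∑ a, christoffel (fun y => g y ρ) i ν a x * (∑ b, (g x ρ)⁻¹ a b * S g x ρ b i)
        - 1 / 2 * pd ν (fun y => STrace g y ρ) x := by
  have hσ := hg.smooth_STrace.differentiableAt_left hg.isOpen hx
  have hraise : ∀ y, (y, ρ) ∈ U → ∀ m i,
      ∑ b, (g y ρ)⁻¹ m b * (S g y ρ - (1 / 2 * STrace g y ρ) • g y ρ) b i
        = ∑ b, (g y ρ)⁻¹ m b * S g y ρ b i
          - (1 / 2 * (1 : Matrix (Fin d) (Fin d) ℝ) m i) * STrace g y ρ := by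
    intro y hy m i
    rw [← (hg.slice ρ).inv_mul hy, Matrix.mul_apply, Finset.mul_sum, Finset.sum_mul,
      ← Finset.sum_sub_distrib]
    refine Finset.sum_congr rfl fun b _ => ?_
    simp only [Matrix.sub_apply, Matrix.smul_apply, smul_eq_mul]
    ring
  have hpd : ∀ m, pd m
      (fun y => ∑ b, (g y ρ)⁻¹ m b * (S g y ρ - (1 / 2 * STrace g y ρ) • g y ρ) b ν) x
      = pd m (fun y => ∑ b, (g y ρ)⁻¹ m b * S g y ρ b ν) x
        - (1 / 2 * (1 : Matrix (Fin d) (Fin d) ℝ) m ν) * pd m (fun y => STrace g y ρ) x := by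
    intro m
    rw [pd_congr (isOpen_slice hg.isOpen ρ) hx (fun y hy => hraise y hy m ν) m,
      pd_sub ((hg.smooth_raised_S m ν).differentiableAt_left hg.isOpen hx) (hσ.const_mul _),
      pd_const_mul _ hσ]
  have hT : ∀ i j, DifferentiableAt ℝ
      (fun y => (S g y ρ - (1 / 2 * STrace g y ρ) • g y ρ) i j) x := fun i j =>
    ((hg.smooth_S i j).differentiableAt_left hg.isOpen hx).fun_sub
      ((hσ.const_mul _).fun_mul ((hg.smooth i j).differentiableAt_left hg.isOpen hx))
  have hΓ : ∑ m, christoffel (fun y => g y ρ) m m ν x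
      = ∑ m, christoffel (fun y => g y ρ) m ν m x :=
    Finset.sum_congr rfl fun m _ => (hg.slice ρ).christoffel_comm hx m m ν
  rw [(hg.slice ρ).div₂_eq hx hT]
  simp only [hpd, hraise x hx, mul_sub, Finset.sum_sub_distrib]
  simp only [Matrix.one_apply, mul_ite, mul_one, mul_zero, ite_mul, zero_mul, Finset.sum_ite_eq',
    Finset.mem_univ, if_true, ← Finset.sum_mul, hΓ]
  ring

theorem deriv_rho_mul {F : (Fin d → ℝ) → ℝ → ℝ} (hF : SmoothFamilyOn U F) (hx : (x, ρ) ∈ U) :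
    deriv (fun r => -(2 * (r * F x r))) ρ = -2 * F x ρ - 2 * ρ * deriv (fun r => F x r) ρ := by
  have h := hF.differentiableAt_right hg.isOpen hx
  rw [deriv.fun_neg, deriv_const_mul_field, deriv_fun_mul (by fun_prop) h]
  simp
  ring

/-- The `∞`-component. The multiples of `S_{∞∞}` on the left are `-1` from `∂_t` in degree `-1`,
`-2` from `∂_∞(-2ρ S_{∞∞})`, `d + 1` from `Γ^K_{K0}` and `-1` from `Γ^∞_{∞0}`. The ambient scalar
curvature is `S - 2ρ S_{∞∞}`; half its derivative, moved to the left, adds `1`, giving `d - 2`, and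
halves the coefficient of `ρ ∂_∞ S_{∞∞}`. -/
theorem second_identity (hx : (x, ρ) ∈ U) :
    div₁ (fun y => g y ρ) (fun y => SInf g y ρ) x
      + (((d : ℝ) - 2) * SInfInf g x ρ - ρ * deriv (fun r => SInfInf g x r) ρ)
      - ρ * trGPrime g x ρ * SInfInf g x ρ
      - 1 / 2 * (∑ μ, ∑ ν, gPrime g x ρ μ ν * SUp g x ρ μ ν)
      - 1 / 2 * deriv (fun r => STrace g x r) ρ = 0 := by
  have h := hg.graded_bianchi hx inftyIdx
  have htr := hg.sum_gradedPd_raised_S hx inftyIdx (-2)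
  have hS := hg.deriv_rho_mul hg.smooth_SInfInf hx
  have hdiv := (hg.slice ρ).div₁_eq (θ := fun y => SInf g y ρ) hx
    (fun i => (hg.smooth_SInf i).differentiableAt_left hg.isOpen hx)
  simp only [gradedPd] at htr
  simp [christoffelTable, mixedTable, gradedPd, weight, htr, hS,
    Finset.sum_add_distrib, -Finset.sum_neg_distrib, ← Finset.sum_mul,
    hg.sum_neg_shape_mul hx] at h
  rw [hg.sum_gPrime_mul_SUp hx, hdiv]
  linarith

/-- The `ν`-component. Here `S_{ν∞}` is collected with `-1 - 2 + (d + 1)` as in the `∞`-component,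
`-1` from `Γ^l_{ν0} = δ^l_ν` and `+1` from `sum_metric_mul_raised`. The scalar curvature contributes
`½ ∂_ν S`, which completes the trace-adjusted divergence, and the term `ρ ∂_ν S_{∞∞}`. -/
theorem first_identity (hx : (x, ρ) ∈ U) (ν : Fin d) :
    div₂ (fun y => g y ρ) (fun y => S g y ρ - (1 / 2 * STrace g y ρ) • g y ρ) ν x
      + ρ * pd ν (fun y => SInfInf g y ρ) x
      + (((d : ℝ) - 2) * SInf g x ρ ν - 2 * ρ * deriv (fun r => SInf g x r ν) ρ)
      - ρ * trGPrime g x ρ * SInf g x ρ ν = 0 := by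
  have h := hg.graded_bianchi hx (spaceIdx ν)
  have htr := hg.sum_gradedPd_raised_S hx (spaceIdx ν) (-2)
  have hS := hg.deriv_rho_mul (hg.smooth_SInf ν) hx
  have hk := hg.sum_metric_mul_raised hx (SInf g x ρ) ν
  have hpd : pd ν (fun y => -(2 * (ρ * SInfInf g y ρ))) x
      = -(2 * (ρ * pd ν (fun y => SInfInf g y ρ) x)) := by
    have h := hg.smooth_SInfInf.differentiableAt_left hg.isOpen hx
    rw [pd_neg, pd_const_mul _ (h.const_mul ρ), pd_const_mul _ h]
  simp only [gradedPd] at htr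
  simp [christoffelTable, mixedTable, gradedPd, weight, htr, hS,
    Finset.sum_add_distrib, -Finset.sum_neg_distrib, ← Finset.sum_mul,
    hg.sum_neg_shape_mul hx, hpd] at h
  rw [hg.div₂_sub_trace hx]
  linarith

end IsSmoothMetricFamilyOn

end Identities

/-! ### From metric families on the manifold to chart components. -/

section Chart

variable {d : ℕ} {M : Type*} [TopologicalSpace M] [ChartedSpace (EuclideanSpace ℝ (Fin d)) M]
  [IsManifold (𝓡 d) ∞ M]

theorem isSmoothMetricFamilyOn_chartComponents {Ω : Set (M × ℝ)}
    {G : (p : M) → ℝ → TangentSpace (𝓡 d) p →L[ℝ] TangentSpace (𝓡 d) p →L[ℝ] ℝ}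
    (hG : IsMetricFamilyOn Ω G) {e : OpenPartialHomeomorph M (EuclideanSpace ℝ (Fin d))}
    (he : e ∈ IsManifold.maximalAtlas (𝓡 d) ∞ M) :
    IsSmoothMetricFamilyOn (chartDomain Ω e) (chartComponents G e) where
  isOpen := by
    have hc : Continuous fun q : (Fin d → ℝ) × ℝ => (WithLp.toLp 2 q.1 : EuclideanSpace ℝ (Fin d)) := by
      fun_prop
    have hW : IsOpen {q : (Fin d → ℝ) × ℝ | WithLp.toLp 2 q.1 ∈ e.target} := e.open_target.preimage hc
    have hcont : ContinuousOn (fun q : (Fin d → ℝ) × ℝ => (e.symm (WithLp.toLp 2 q.1), q.2))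
        {q | WithLp.toLp 2 q.1 ∈ e.target} :=
      (e.continuousOn_symm.comp hc.continuousOn fun _ h => h).prodMk continuousOn_snd
    exact hcont.isOpen_inter_preimage hW hG.isOpen
  symm x ρ hx := by
    ext μ ν
    exact hG.symm _ _ hx.2 _ _
  det_ne_zero x ρ hx h0 := by
    -- A kernel vector of the Gram matrix is pushed forward by the derivative of `e.symm`. As that
    -- derivative is onto, the image is orthogonal to every tangent vector, hence zero; as it is
    -- injective, the kernel vector is zero.
    obtain ⟨v, hv, hv0⟩ := Matrix.exists_mulVec_eq_zero_iff.2 h0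
    have hmd : e.symm.MDifferentiable (𝓡 d) (𝓡 d) :=
      ⟨(contMDiffOn_symm_of_mem_maximalAtlas he).mdifferentiableOn (by simp),
        (contMDiffOn_of_mem_maximalAtlas he).mdifferentiableOn (by simp)⟩
    have hbij := hmd.mfderiv_bijective hx.1
    set φ := mfderiv (𝓡 d) (𝓡 d) e.symm (WithLp.toLp 2 x) with hφ
    have hexp : ∀ w : EuclideanSpace ℝ (Fin d),
        w = ∑ μ, w μ • EuclideanSpace.single μ (1 : ℝ) := by
      intro w
      ext i
      simp [Finset.sum_apply, Pi.single_apply]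
    have hφexp : ∀ w : EuclideanSpace ℝ (Fin d),
        φ w = ∑ μ, w μ • φ (EuclideanSpace.single μ (1 : ℝ)) := by
      intro w
      conv_lhs => rw [hexp w]
      exact (map_sum φ _ _).trans (Finset.sum_congr rfl fun μ _ => map_smul φ _ _)
    have hzero : φ (WithLp.toLp 2 v) = 0 := by
      refine hG.nondegenerate _ _ hx.2 _ fun w => ?_
      obtain ⟨u, rfl⟩ := hbij.2 w
      rw [hφexp u, map_sum]
      refine Finset.sum_eq_zero fun μ _ => ?_
      rw [map_smul, hG.symm _ _ hx.2, hφexp (WithLp.toLp 2 v), map_sum]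
      simp only [map_smul]
      have h : ∑ ν, v ν • G (e.symm (WithLp.toLp 2 x)) ρ (φ (EuclideanSpace.single μ (1 : ℝ)))
          (φ (EuclideanSpace.single ν (1 : ℝ))) = 0 :=
        Eq.trans (Finset.sum_congr rfl fun ν _ => mul_comm _ _) (congrFun hv0 μ)
      exact (congrArg _ h).trans (smul_zero _)
    have hv1 : WithLp.toLp 2 v = (0 : EuclideanSpace ℝ (Fin d)) :=
      hbij.1 (hzero.trans (map_zero φ).symm)
    exact hv (by simpa using hv1)
  smooth μ ν := hG.smooth e he μ ν

end Chart

end AmbientBianchi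

end

theorem mainTheorem10 {d : ℕ} {M : Type*} [TopologicalSpace M]
    [ChartedSpace (EuclideanSpace ℝ (Fin d)) M] [IsManifold (𝓡 d) ∞ M]
    (Ω : Set (M × ℝ))
    (G : (p : M) → ℝ → TangentSpace (𝓡 d) p →L[ℝ] TangentSpace (𝓡 d) p →L[ℝ] ℝ)
    (hG : AmbientBianchi.IsMetricFamilyOn Ω G)
    (e : OpenPartialHomeomorph M (EuclideanSpace ℝ (Fin d)))
    (he : e ∈ IsManifold.maximalAtlas (𝓡 d) ∞ M)
    (g : (Fin d → ℝ) → ℝ → Matrix (Fin d) (Fin d) ℝ)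
    (hg : g = AmbientBianchi.chartComponents G e)
    (x : Fin d → ℝ) (ρ : ℝ) (hx : (x, ρ) ∈ AmbientBianchi.chartDomain Ω e) :
    -- the ambient Ricci tensor has no `0`-components and does not depend on `t`
    (∀ t : ℝ, 0 < t → ∀ I J : AmbientBianchi.AmbientIndex d,
      AmbientBianchi.ambientRicci g AmbientBianchi.zeroIdx J t x ρ = 0 ∧
      AmbientBianchi.ambientRicci g I AmbientBianchi.zeroIdx t x ρ = 0 ∧
      AmbientBianchi.ambientRicci g I J t x ρ = AmbientBianchi.slicedRicci g I J x ρ) ∧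
    -- the first identity
    (∀ ν : Fin d,
      AmbientBianchi.div₂ (fun y => g y ρ)
          (fun y => AmbientBianchi.S g y ρ - (1 / 2 * AmbientBianchi.STrace g y ρ) • g y ρ) ν x
        + ρ * AmbientBianchi.pd ν (fun y => AmbientBianchi.SInfInf g y ρ) x
        + (((d : ℝ) - 2) * AmbientBianchi.SInf g x ρ ν
            - 2 * ρ * deriv (fun r => AmbientBianchi.SInf g x r ν) ρ)
        - ρ * AmbientBianchi.trGPrime g x ρ * AmbientBianchi.SInf g x ρ ν = 0) ∧
    -- the second identity
    AmbientBianchi.div₁ (fun y => g y ρ) (fun y => AmbientBianchi.SInf g y ρ) x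
      + (((d : ℝ) - 2) * AmbientBianchi.SInfInf g x ρ
          - ρ * deriv (fun r => AmbientBianchi.SInfInf g x r) ρ)
      - ρ * AmbientBianchi.trGPrime g x ρ * AmbientBianchi.SInfInf g x ρ
      - 1 / 2 * (∑ μ, ∑ ν, AmbientBianchi.gPrime g x ρ μ ν * AmbientBianchi.SUp g x ρ μ ν)
      - 1 / 2 * deriv (fun r => AmbientBianchi.STrace g x r) ρ = 0 := by
  subst hg
  have h := AmbientBianchi.isSmoothMetricFamilyOn_chartComponents hG he
  refine ⟨fun t ht I J => ⟨?_, ?_, h.ambientRicci_eq_slicedRicci ht hx I J⟩,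
    fun ν => h.first_identity hx ν, h.second_identity hx⟩
  · rw [h.ambientRicci_eq_slicedRicci ht hx, h.slicedRicci_zero_left hx]
  · rw [h.ambientRicci_eq_slicedRicci ht hx, h.slicedRicci_zero_right hx]
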